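/- Let $R$ be a noetherian commutative ring, $S=\operatorname{Spec} R$, $A$ a commutative Hopf algebra over $R$ which is finite and flat as an $R$-module, $G=\operatorname{Spec} A$ the corresponding finite flat group scheme over $S$, and let $G$ act on the right on an affine $S$-scheme $X=\operatorname{Spec} B$ through a coaction $\rho: B\to B\otimes_R A$. Let $C=\{b\in B : \rho(b)=b\otimes 1\}$ be the ring of invariants, $Y=\operatorname{Spec} C$, and $\pi: X\to Y$ the induced morphism. For a $Y$-scheme $Y'$ put $X_{Y'}=X\times_Y Y'$ and $G_{Y'}=G\times_S Y'$; then $G_{Y'}$ acts on $X_{Y'}$ over $Y'$, and the Galois map of this action is $X_{Y'}\times_{Y'}G_{Y'}\to X_{Y'}\times_{Y'}X_{Y'}$, $(x,g)\mapsto (x\cdot g,x)$. The action $(X_{Y'},G_{Y'})$ is called free if its Galois map is a closed immersion; $X_{Y'}$ is a $G$-torsor over $Y'$ if $X_{Y'}\to Y'$ is faithfully flat and finitely presented and the Galois map is an isomorphism. The inertia group scheme at a point $p'\in X_{Y'}$ is the fibre product of the Galois map with $\operatorname{Spec} k(p')\to X_{Y'}\xrightarrow{\Delta} X_{Y'}\times_{Y'}X_{Y'}$,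 a group scheme over $k(p')$. Theorem. Let $p\in X$ and $q=\pi(p)\in Y$. The following are equivalent: (i) the inertia at $p$ is trivial after a finite base change: there are a finite morphism $Y_1\to Y$ and a point $p_1\in X_{Y_1}$ above $p$ such that the inertia group scheme of $(X_{Y_1},G_{Y_1})$ at $p_1$ is trivial; (ii) there is a flat, finitely presented morphism $Y'\to Y$ whose image contains $q$ such that the action of $G_{Y'}$ on $X_{Y'}$ over $Y'$ is free; (iii) there are an open subscheme $U\subseteq Y$ and a finite flat morphism $Y'\to U$ whose image contains $q$ such that the action of $G_{Y'}$ on $X_{Y'}$ over $Y'$ is free. Moreover, for every flat morphism $Y'\to Y$, the action of $G_{Y'}$ on $X_{Y'}$ over $Y'$ is free if and only if $X_{Y'}$ is a $G$-torsor over $Y'$. -/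

import Mathlib

open CategoryTheory CategoryTheory.Limits AlgebraicGeometry TensorProduct

universe u

noncomputable section

namespace HopfAction

section Schemes

/-- The data, over a base scheme `T`, that the Galois map of a right action of a `T`-group scheme
`G` on a `T`-scheme `X` depends on: the two structure morphisms and the `T`-morphism
`act : X ×_T G ⟶ X`, `(x, g) ↦ x · g`. It is only ever used for actions coming from a coaction
of a Hopf algebra (see `actionOverQuotient`) and its base changes; there the
group law and the axioms of an action are those of the Hopf algebra and of the coaction. -/
structure ActionMap (T : Scheme.{u}) where
  X : Scheme.{u}
  G : Scheme.{u}
  x : X ⟶ T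
  g : G ⟶ T
  act : pullback x g ⟶ X
  act_over : act ≫ x = pullback.fst x g ≫ x

namespace ActionMap

variable {T : Scheme.{u}} (a : ActionMap T)

/-- The Galois map `X ×_T G ⟶ X ×_T X`, `(x, g) ↦ (x · g, x)`. -/
def galois : pullback a.x a.g ⟶ pullback a.x a.x :=
  pullback.lift a.act (pullback.fst a.x a.g) a.act_over

/-- The inertia group scheme at `p`: the fibre product of the Galois map with
`Spec k(p) ⟶ X ⟶ X ×_T X` (the second morphism being the diagonal). -/
def inertia (p : a.X) : Scheme.{u} :=
  pullback a.galois (a.X.fromSpecResidueField p ≫ pullback.diagonal a.x)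

/-- The structure morphism of the inertia group scheme at `p`. -/
def inertiaToSpec (p : a.X) : a.inertia p ⟶ Spec (a.X.residueField p) :=
  pullback.snd a.galois (a.X.fromSpecResidueField p ≫ pullback.diagonal a.x)

/-- The inertia group scheme at `p` is the trivial group scheme over `k(p)`. -/
def InertiaTrivial (p : a.X) : Prop := IsIso (a.inertiaToSpec p)

/-- The action is free: the Galois map is a closed immersion. -/
def IsFree : Prop := IsClosedImmersion a.galois

/-- `X` is a `G`-torsor over `T`: `X ⟶ T` is fppf (faithfully flat and finitely presented) and
the Galois map is an isomorphism. -/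
structure IsTorsor : Prop where
  flat : Flat a.x
  surjective : Surjective a.x
  locallyOfFinitePresentation : LocallyOfFinitePresentation a.x
  quasiCompact : QuasiCompact a.x
  quasiSeparated : QuasiSeparated a.x
  isIso_galois : IsIso a.galois

/-- The base change of an action along `f : T' ⟶ T`: the action of `G ×_T T'` on `X ×_T T'` over
`T'`, `((x, t), (g, t)) ↦ (x · g, t)`. -/
def baseChange {T' : Scheme.{u}} (f : T' ⟶ T) : ActionMap T' where
  X := pullback a.x f
  G := pullback a.g f
  x := pullback.snd a.x f
  g := pullback.snd a.g f
  act := pullback.lift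
    (pullback.lift
      (pullback.fst (pullback.snd a.x f) (pullback.snd a.g f) ≫ pullback.fst a.x f)
      (pullback.snd (pullback.snd a.x f) (pullback.snd a.g f) ≫ pullback.fst a.g f)
      (by rw [Category.assoc, Category.assoc, pullback.condition, pullback.condition,
            ← Category.assoc, ← Category.assoc, pullback.condition]) ≫ a.act)
    (pullback.fst (pullback.snd a.x f) (pullback.snd a.g f) ≫ pullback.snd a.x f)
    (by rw [Category.assoc, a.act_over, pullback.lift_fst_assoc, Category.assoc, Category.assoc,
          pullback.condition])
  act_over := pullback.lift_snd _ _ _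

/-- The projection `X ×_T T' ⟶ X` of a base change. -/
def baseChangeFst {T' : Scheme.{u}} (f : T' ⟶ T) : (a.baseChange f).X ⟶ a.X :=
  pullback.fst a.x f

end ActionMap

end Schemes

section Coaction

variable {R A B : Type u} [CommRing R] [CommRing A] [HopfAlgebra R A] [CommRing B] [Algebra R B]

/-- `ρ : B → B ⊗ A` makes the `R`-algebra `B` a right `A`-comodule algebra, i.e. `Spec ρ` is a right
action of the group scheme `Spec A` on `Spec B` over `Spec R`. -/
structure IsCoaction (ρ : B →ₐ[R] B ⊗[R] A) : Prop where
  coassoc : ((Algebra.TensorProduct.assoc R R R B A A : (B ⊗[R] A) ⊗[R] A →ₐ[R] _).comp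
      (Algebra.TensorProduct.map ρ (AlgHom.id R A))).comp ρ =
    (Algebra.TensorProduct.map (AlgHom.id R B) (Bialgebra.comulAlgHom R A)).comp ρ
  counit : ((Algebra.TensorProduct.rid R R B : B ⊗[R] R →ₐ[R] B).comp
      (Algebra.TensorProduct.map (AlgHom.id R B) (Bialgebra.counitAlgHom R A))).comp ρ =
    AlgHom.id R B

variable (ρ : B →ₐ[R] B ⊗[R] A)

/-- The ring of invariants `C = {b ∈ B | ρ b = b ⊗ 1}`. -/
def invariants : Subalgebra R B :=
  AlgHom.equalizer ρ (Algebra.TensorProduct.includeLeft : B →ₐ[R] B ⊗[R] A)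

/-- The quotient `Y = Spec C`. -/
abbrev quotient : Scheme.{u} := Spec (.of (invariants ρ))

/-- The morphism `π : X = Spec B ⟶ Y = Spec C` induced by the inclusion `C ⊆ B`. -/
abbrev quotientMap : Spec (.of B) ⟶ quotient ρ :=
  Spec.map (CommRingCat.ofHom (algebraMap (invariants ρ) B))

variable (R) in
/-- The structure morphism `Spec D ⟶ S = Spec R` of an `R`-algebra `D`. -/
abbrev toBase (D : Type u) [CommRing D] [Algebra R D] : Spec (.of D) ⟶ Spec (.of R) :=
  Spec.map (CommRingCat.ofHom (algebraMap R D))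

/-- The action morphism `X ×_S G ≅ Spec (B ⊗ A) ⟶ X` given by a coaction `ρ`. -/
def actMap : pullback (toBase R B) (toBase R A) ⟶ Spec (.of B) :=
  (pullbackSpecIso R B A).hom ≫ Spec.map (CommRingCat.ofHom ρ.toRingHom)

lemma quotientMap_toBase : quotientMap ρ ≫ toBase R (invariants ρ) = toBase R B := by
  rw [← Spec.map_comp, ← CommRingCat.ofHom_comp]
  rfl

lemma actMap_quotientMap :
    actMap ρ ≫ quotientMap ρ = pullback.fst (toBase R B) (toBase R A) ≫ quotientMap ρ := by
  rw [actMap, ← pullbackSpecIso_hom_fst, Category.assoc, Category.assoc, ← Spec.map_comp,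
    ← Spec.map_comp, ← CommRingCat.ofHom_comp, ← CommRingCat.ofHom_comp]
  congr 3
  ext c
  exact c.2

/-- The action of `G = Spec A` on `X = Spec B` given by a coaction `ρ`, viewed over `Y`: the action
of `G_Y = G ×_S Y` on the `Y`-scheme `X`, with action morphism `X ×_Y G_Y ⟶ X ×_S G ⟶ X`. -/
def actionOverQuotient : ActionMap (quotient ρ) where
  X := Spec (.of B)
  G := pullback (toBase R A) (toBase R (invariants ρ))
  x := quotientMap ρ
  g := pullback.snd (toBase R A) (toBase R (invariants ρ))
  act := pullback.lift
    (pullback.fst (quotientMap ρ) (pullback.snd (toBase R A) (toBase R (invariants ρ))))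
    (pullback.snd (quotientMap ρ) (pullback.snd (toBase R A) (toBase R (invariants ρ))) ≫
      pullback.fst (toBase R A) (toBase R (invariants ρ)))
    (by rw [← quotientMap_toBase ρ, ← Category.assoc, pullback.condition, Category.assoc,
          Category.assoc, pullback.condition]) ≫ actMap ρ
  act_over := by
    rw [Category.assoc, actMap_quotientMap, pullback.lift_fst_assoc]

end Coaction

end HopfAction

end

open HopfAction

/-! ### Integrals on finite projective Hopf algebras -/

noncomputable section

namespace HopfAction

section Trace

variable {S M N ι κ : Type*} [CommRing S] [AddCommGroup M] [Module S M] [AddCommGroup N]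
  [Module S N] [Fintype ι] [Fintype κ]

/-! Write F for `freeIdeal ρ`, the annihilator in B of the cokernel of the Galois map B ⊗_C B → B
⊗_R A, x ⊗ y ↦ x ρ(y). Each of the three conditions amounts to one algebraic statement: some
invariant c ∈ F ∩ C does not vanish at p. The neighbourhood of q can then be the basic open set D(c)
of Y.

Triviality of the inertia gives F ⊄ p. For x : B → K with trivial stabilizer, the comorphism K ⊗ B →
K ⊗ A of the orbit map is a finite epimorphism of rings, hence surjective (`orbitMap_surjective`).
So the cokernel, a finite B-module, has zero fibre at x, and its annihilator does not vanish there.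

Passing from F to F ∩ C uses integrals. Since A is finite projective over R, the counit is a sum of
functionals l_i(t_i ·) with l_i integrals (`exists_integrals`); traces in dual bases produce them,
so A need not be free. An integral l gives a C-linear trace b ↦ b₀ l(b₁) from B to C. Writing s ⊗
t_i in terms of ρ(B) for s ∈ F yields s y = ∑ a_i tr_i(b_i y) (`exists_formula`). With y = s, and
with F stable under contraction (`contract_mem_freeIdeal`), this puts s² in the ideal generated by F
∩ C (`exists_invariant`).

For c ∈ F ∩ C, the same formula makes B_c finite projective over C_c and shows that c kills the
kernel of the Galois map. Hence over D(c) points of X with equal invariants differ by a unique point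
of G. The Galois map there is a finite monomorphism, that is, a closed immersion, and even an
isomorphism. Surjectivity of X → Y comes from integrality of B over C, proved with characteristic
polynomials. Thus free actions over Y' are torsors. -/

/-- A family of vectors and a family of functionals form a dual basis. -/
def IsDualBasis (e : ι → M) (e' : ι → M →ₗ[S] S) : Prop := ∀ x, ∑ i, e' i x • e i = x

/-- Cyclicity of the trace, computed in dual bases. -/
lemma IsDualBasis.sum_comp_comm {e : ι → M} {e' : ι → M →ₗ[S] S} (he : IsDualBasis e e')
    {d : κ → N} {d' : κ → N →ₗ[S] S} (hd : IsDualBasis d d') (F : M →ₗ[S] N) (G : N →ₗ[S] M) :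
    ∑ i, e' i (G (F (e i))) = ∑ k, d' k (F (G (d k))) := by
  calc ∑ i, e' i (G (F (e i))) = ∑ i, ∑ k, d' k (F (e i)) * e' i (G (d k)) := by
        refine Finset.sum_congr rfl fun i _ => ?_
        conv_lhs => rw [← hd (F (e i))]
        simp
    _ = ∑ k, ∑ i, e' i (G (d k)) * d' k (F (e i)) := by
        rw [Finset.sum_comm]
        simp_rw [mul_comm]
    _ = _ := by
        refine Finset.sum_congr rfl fun k _ => ?_
        conv_rhs => rw [← he (G (d k))]
        simp

variable (S M) in
lemma exists_isDualBasis [Module.Finite S M] [Module.Projective S M] :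
    ∃ (n : ℕ) (e : Fin n → M) (e' : Fin n → M →ₗ[S] S), IsDualBasis e e' := by
  obtain ⟨n, f, g, -, -, h⟩ := Module.Finite.exists_comp_eq_id_of_projective S M
  refine ⟨n, fun i => f (Pi.single i 1), fun i => LinearMap.proj i ∘ₗ g, fun x => ?_⟩
  conv_rhs => rw [← LinearMap.id_apply (R := S) x, ← h]
  rw [LinearMap.comp_apply]
  conv_rhs => rw [pi_eq_sum_univ' (g x)]
  simp only [map_sum, map_smul, LinearMap.comp_apply, LinearMap.proj_apply]

lemma IsDualBasis.tensor {e : ι → M} {e' : ι → M →ₗ[S] S} (he : IsDualBasis e e')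
    {d : κ → N} {d' : κ → N →ₗ[S] S} (hd : IsDualBasis d d') :
    IsDualBasis (fun p : ι × κ => e p.1 ⊗ₜ[S] d p.2)
      (fun p => TensorProduct.dualDistrib S M N (e' p.1 ⊗ₜ d' p.2)) := by
  intro x
  induction x with
  | zero => simp
  | add x y hx hy => simp only [map_add, add_smul, Finset.sum_add_distrib, hx, hy]
  | tmul x y =>
    conv_rhs => rw [← he x, ← hd y]
    simp_rw [TensorProduct.sum_tmul, TensorProduct.tmul_sum, TensorProduct.smul_tmul_smul]
    simp [Fintype.sum_prod_type]

variable {S' : Type*} [CommRing S'] [Algebra S S']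

lemma IsDualBasis.baseChange {e : ι → M} {e' : ι → M →ₗ[S] S} (he : IsDualBasis e e') :
    IsDualBasis (fun i => (1 : S') ⊗ₜ[S] e i)
      (fun i => (TensorProduct.AlgebraTensorModule.rid S S' S').toLinearMap ∘ₗ
        (e' i).baseChange S') := by
  intro x
  induction x with
  | zero => simp
  | add x y hx hy => simp only [map_add, add_smul, Finset.sum_add_distrib, hx, hy]
  | tmul s y =>
    conv_rhs => rw [← he y]
    simp [TensorProduct.tmul_sum, TensorProduct.smul_tmul']

end Trace

section Integral

variable {R A : Type*} [CommRing R] [CommRing A] [HopfAlgebra R A]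

open Coalgebra WithConv

/-- The endomorphism `h ↦ h₁ f(h₂)`. -/
def rightContract (f : A →ₗ[R] R) : A →ₗ[R] A :=
  (TensorProduct.rid R A).toLinearMap ∘ₗ f.lTensor A ∘ₗ comul

/-- Left integrals on a Hopf algebra: functionals `f` with `h₁ f(h₂) = f(h) 1`. -/
def IsIntegral (f : A →ₗ[R] R) : Prop := ∀ h, rightContract f h = algebraMap R A (f h)

lemma apply_rightContract (f g : A →ₗ[R] R) (h : A) :
    g (rightContract f h) = TensorProduct.dualDistrib R A A (g ⊗ₜ f) (comul h) := by
  have : g ∘ₗ (TensorProduct.rid R A).toLinearMap ∘ₗ f.lTensor A =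
      TensorProduct.dualDistrib R A A (g ⊗ₜ f) := by
    ext a b
    simp [mul_comm]
  exact LinearMap.congr_fun this (comul h)

/-- Coassociativity: both sides contract the last factor of h₁ ⊗ h₂ ⊗ h₃ with f. -/
lemma comul_rightContract (f : A →ₗ[R] R) (h : A) :
    comul (rightContract f h) = (rightContract f).lTensor A (comul (R := R) h) := by
  have h1 : (rightContract f).lTensor A (comul (R := R) h) =
      (TensorProduct.rid R A).toLinearMap.lTensor A ((f.lTensor A).lTensor A
        (comul.lTensor A (comul (R := R) h))) := by
    simp [rightContract, LinearMap.lTensor_comp]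
  have h2 : ∀ z : A ⊗[R] A, (TensorProduct.rid R A).toLinearMap.lTensor A ((f.lTensor A).lTensor A
      (TensorProduct.assoc R A A A (comul.rTensor A z))) =
      comul ((TensorProduct.rid R A) (f.lTensor A z)) := by
    intro z
    induction z with
    | zero => simp
    | add x y hx hy => simp only [map_add, hx, hy]
    | tmul x y =>
      simp only [LinearMap.rTensor_tmul, LinearMap.lTensor_tmul, TensorProduct.rid_tmul, map_smul]
      generalize comul (R := R) x = w
      induction w with
      | zero => simp
      | add x y hx hy => simp only [map_add, hx, hy, TensorProduct.add_tmul, smul_add]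
      | tmul a b => simp
  rw [h1, ← coassoc_apply, h2]
  rfl

/-- The functional `x ↦ tr (h ↦ (x h)₁ f((x h)₂))`. -/
def traceIntegral {ι : Type*} [Fintype ι] (e : ι → A) (e' : ι → A →ₗ[R] R) (f : A →ₗ[R] R) :
    A →ₗ[R] R :=
  ∑ j, e' j ∘ₗ rightContract f ∘ₗ LinearMap.mulRight R (e j)

lemma traceIntegral_apply {ι : Type*} [Fintype ι] (e : ι → A) (e' : ι → A →ₗ[R] R)
    (f : A →ₗ[R] R) (x : A) :
    traceIntegral e e' f x = ∑ j, e' j (rightContract f (x * e j)) := by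
  simp [traceIntegral]

section Points

variable {W W' : Type*} [CommRing W] [CommRing W'] [Algebra R W] [Algebra R W']

/-- The inverse of a point of the group scheme `Spec A`. -/
def inversePoint (g : WithConv (A →ₐ[R] W)) : WithConv (A →ₐ[R] W) :=
  toConv (g.ofConv.comp (HopfAlgebra.antipodeAlgHom R A))

lemma inversePoint_mul_self (g : WithConv (A →ₐ[R] W)) : inversePoint g * g = 1 := by
  have h := congrArg (fun k => toConv (g.ofConv.comp (ofConv k)))
    (AlgHom.antipode_id_cancel (R := R) (A := A))
  simp only [AlgHom.comp_convMul_distrib] at h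
  refine Eq.trans h ?_
  ext a
  simp [AlgHom.convOne_def]

lemma self_mul_inversePoint (g : WithConv (A →ₐ[R] W)) : g * inversePoint g = 1 := by
  have h := congrArg (fun k => toConv (g.ofConv.comp (ofConv k)))
    (mul_eq_one_comm.mp (AlgHom.antipode_id_cancel (R := R) (A := A)))
  simp only [AlgHom.comp_convMul_distrib] at h
  refine Eq.trans h ?_
  ext a
  simp [AlgHom.convOne_def]

lemma comp_inversePoint (h : W →ₐ[R] W') (g : WithConv (A →ₐ[R] W)) :
    h.comp (inversePoint g).ofConv = (inversePoint (toConv (h.comp g.ofConv))).ofConv := rfl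

lemma inversePoint_mul_cancel_left (g k : WithConv (A →ₐ[R] W)) :
    inversePoint g * (g * k) = k := by
  rw [← mul_assoc, inversePoint_mul_self, one_mul]

lemma mul_inversePoint_cancel_left (g k : WithConv (A →ₐ[R] W)) :
    g * (inversePoint g * k) = k := by
  rw [← mul_assoc, self_mul_inversePoint, one_mul]

end Points

variable (R A) in
/-- The automorphism `(g, h) ↦ (g, g h)` on functions. -/
def shear : A ⊗[R] A →ₐ[A] A ⊗[R] A :=
  Algebra.TensorProduct.lift (Algebra.ofId A (A ⊗[R] A))
    (toConv (Algebra.TensorProduct.includeLeft : A →ₐ[R] A ⊗[R] A) *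
      toConv (Algebra.TensorProduct.includeRight : A →ₐ[R] A ⊗[R] A)).ofConv
    (fun _ _ => Commute.all _ _)

variable (R A) in
/-- The automorphism `(g, h) ↦ (g, g⁻¹ h)` on functions. -/
def unshear : A ⊗[R] A →ₐ[A] A ⊗[R] A :=
  Algebra.TensorProduct.lift (Algebra.ofId A (A ⊗[R] A))
    (inversePoint (toConv (Algebra.TensorProduct.includeLeft : A →ₐ[R] A ⊗[R] A)) *
      toConv (Algebra.TensorProduct.includeRight : A →ₐ[R] A ⊗[R] A)).ofConv
    (fun _ _ => Commute.all _ _)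

lemma shear_unshear (z : A ⊗[R] A) : shear R A (unshear R A z) = z := by
  have h1 : ((shear R A).restrictScalars R).comp Algebra.TensorProduct.includeLeft =
      (Algebra.TensorProduct.includeLeft : A →ₐ[R] A ⊗[R] A) := by
    ext a; simp [shear, Algebra.ofId_apply]
  have h2 : ((shear R A).restrictScalars R).comp Algebra.TensorProduct.includeRight =
      (toConv (Algebra.TensorProduct.includeLeft : A →ₐ[R] A ⊗[R] A) *
      toConv (Algebra.TensorProduct.includeRight : A →ₐ[R] A ⊗[R] A)).ofConv := by
    ext a; simp [shear]
  have h3 : ((shear R A).restrictScalars R).comp (((unshear R A).restrictScalars R).comp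
      Algebra.TensorProduct.includeRight) =
      (Algebra.TensorProduct.includeRight : A →ₐ[R] A ⊗[R] A) := by
    have : (((unshear R A).restrictScalars R).comp Algebra.TensorProduct.includeRight) =
      (inversePoint (toConv (Algebra.TensorProduct.includeLeft : A →ₐ[R] A ⊗[R] A)) *
      toConv (Algebra.TensorProduct.includeRight : A →ₐ[R] A ⊗[R] A)).ofConv := by
      ext a; simp [unshear]
    rw [this, AlgHom.comp_convMul_distrib, comp_inversePoint]
    simp only [toConv_ofConv, h1, h2]
    rw [inversePoint_mul_cancel_left]
  have : (shear R A).comp (unshear R A) = AlgHom.id A _ := by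
    ext a
    exact DFunLike.congr_fun h3 a
  exact DFunLike.congr_fun this z

lemma unshear_shear (z : A ⊗[R] A) : unshear R A (shear R A z) = z := by
  have h1 : ((unshear R A).restrictScalars R).comp Algebra.TensorProduct.includeLeft =
      (Algebra.TensorProduct.includeLeft : A →ₐ[R] A ⊗[R] A) := by
    ext a; simp [unshear, Algebra.ofId_apply]
  have h2 : ((unshear R A).restrictScalars R).comp Algebra.TensorProduct.includeRight =
      (inversePoint (toConv (Algebra.TensorProduct.includeLeft : A →ₐ[R] A ⊗[R] A)) *
      toConv (Algebra.TensorProduct.includeRight : A →ₐ[R] A ⊗[R] A)).ofConv := by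
    ext a; simp [unshear]
  have h3 : ((unshear R A).restrictScalars R).comp (((shear R A).restrictScalars R).comp
      Algebra.TensorProduct.includeRight) =
      (Algebra.TensorProduct.includeRight : A →ₐ[R] A ⊗[R] A) := by
    have : (((shear R A).restrictScalars R).comp Algebra.TensorProduct.includeRight) =
      (toConv (Algebra.TensorProduct.includeLeft : A →ₐ[R] A ⊗[R] A) *
      toConv (Algebra.TensorProduct.includeRight : A →ₐ[R] A ⊗[R] A)).ofConv := by
      ext a; simp [shear]
    rw [this, AlgHom.comp_convMul_distrib]
    simp only [toConv_ofConv, h1, h2]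
    rw [mul_inversePoint_cancel_left]
  have : (unshear R A).comp (shear R A) = AlgHom.id A _ := by
    ext a
    exact DFunLike.congr_fun h3 a
  exact DFunLike.congr_fun this z

lemma shear_tmul (a h : A) : shear R A (a ⊗ₜ h) = a • comul (R := R) h := by
  have : Algebra.TensorProduct.lift (Algebra.TensorProduct.includeLeft : A →ₐ[R] A ⊗[R] A)
      (Algebra.TensorProduct.includeRight : A →ₐ[R] A ⊗[R] A) (fun _ _ => Commute.all _ _) =
      AlgHom.id R _ := by
    ext <;> simp
  rw [shear, Algebra.TensorProduct.lift_tmul, Algebra.ofId_apply, ← Algebra.smul_def]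
  congr 1
  refine (AlgHom.convMul_apply _ _ h).trans ?_
  simp only
  rw [this, AlgHom.id_apply]

/-- Over A, the endomorphism h ↦ (x h)₁ f((x h)₂) is conjugate under the shear (g, h) ↦ (g, g h) to
the one with x replaced by Δ(x). The two traces therefore agree; they are Λ(x) 1 and x₁ Λ(x₂), with
Λ the functional in question. -/
lemma IsDualBasis.isIntegral_traceIntegral {ι : Type*} [Fintype ι] {e : ι → A}
    {e' : ι → A →ₗ[R] R} (he : IsDualBasis e e') (f : A →ₗ[R] R) :
    IsIntegral (traceIntegral e e' f) := by
  intro x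
  let Q : A ⊗[R] A →ₗ[A] A ⊗[R] A := (rightContract f ∘ₗ LinearMap.mulLeft R x).baseChange A
  let Q' : A ⊗[R] A →ₗ[A] A ⊗[R] A :=
    (rightContract f).baseChange A ∘ₗ LinearMap.mulLeft A (comul (R := R) x)
  -- The shear intertwines Q and Q': Δ is multiplicative and commutes with right contraction.
  have hQ : ∀ z, Q' ((shear R A).toLinearMap z) = (shear R A).toLinearMap (Q z) := by
    suffices Q' ∘ₗ (shear R A).toLinearMap = (shear R A).toLinearMap ∘ₗ Q from
      LinearMap.congr_fun this
    ext h
    have : Q' (comul (R := R) h) = comul (rightContract f (x * h)) := by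
      rw [comul_rightContract]
      simp [Q', LinearMap.baseChange_eq_ltensor]
    simpa [shear_tmul, Q] using this
  have key := (he.baseChange (S' := A)).sum_comp_comm (he.baseChange (S' := A))
    (shear R A).toLinearMap (Q ∘ₗ (unshear R A).toLinearMap)
  simp only [LinearMap.comp_apply (f := Q), ← hQ] at key
  simp only [AlgHom.toLinearMap_apply, shear_unshear, unshear_shear] at key
  have h1 : ∑ i, (((TensorProduct.AlgebraTensorModule.rid R A A).toLinearMap ∘ₗ
      (e' i).baseChange A) (Q (1 ⊗ₜ e i))) = algebraMap R A (traceIntegral e e' f x) := by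
    simp [Q, traceIntegral_apply, Algebra.algebraMap_eq_smul_one]
  have h2 : ∑ i, (((TensorProduct.AlgebraTensorModule.rid R A A).toLinearMap ∘ₗ
      (e' i).baseChange A) (Q' (1 ⊗ₜ e i))) = rightContract (traceIntegral e e' f) x := by
    simp only [Q', rightContract, LinearMap.comp_apply, LinearMap.mulLeft_apply]
    generalize comul (R := R) x = z
    induction z with
    | zero => simp
    | add z w hz hw => simp only [add_mul, map_add, Finset.sum_add_distrib, hz, hw]
    | tmul a b => simp [traceIntegral_apply, rightContract, Finset.sum_smul]
  rw [← h1, ← h2]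
  exact key.symm

/-- The left side is the trace of Δ ∘ m on A ⊗ A, where m(a ⊗ b) = x a S(b). By cyclicity it is the
trace of m ∘ Δ on A, and the antipode axiom turns m ∘ Δ into y ↦ ε(y) x, of trace ε(x). -/
lemma IsDualBasis.sum_traceIntegral {ι : Type*} [Fintype ι] {e : ι → A}
    {e' : ι → A →ₗ[R] R} (he : IsDualBasis e e') (x : A) :
    ∑ i, traceIntegral e e' (e' i) (x * HopfAlgebra.antipode R (e i)) = counit (R := R) x := by
  let m : A ⊗[R] A →ₗ[R] A := LinearMap.mulLeft R x ∘ₗ LinearMap.mul' R A ∘ₗ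
    (HopfAlgebra.antipode R).lTensor A
  have hm : ∀ y, m (comul y) = counit (R := R) y • x := by
    intro y
    simp [m, Algebra.algebraMap_eq_smul_one]
  have key := (he.tensor he).sum_comp_comm he m comul
  simp only [hm, map_smul, ← apply_rightContract, Fintype.sum_prod_type] at key
  rw [Finset.sum_comm] at key
  refine Eq.trans ?_ (key.trans ?_)
  · simp [traceIntegral_apply, m, mul_comm, mul_left_comm]
  · conv_rhs => rw [← he x]
    simp [mul_comm]

variable (R A) in
/-- The counit is a combination of translates of integrals. -/
lemma exists_integrals [Module.Finite R A] [Module.Projective R A] :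
    ∃ (n : ℕ) (l : Fin n → A →ₗ[R] R) (t : Fin n → A), (∀ i, IsIntegral (l i)) ∧
      ∀ x, ∑ i, l i (t i * x) = counit (R := R) x := by
  obtain ⟨n, e, e', he⟩ := exists_isDualBasis R A
  refine ⟨n, fun i => traceIntegral e e' (e' i), fun i => HopfAlgebra.antipode R (e i),
    fun i => he.isIntegral_traceIntegral _, fun x => ?_⟩
  simp_rw [mul_comm _ x]
  exact he.sum_traceIntegral x

end Integral

/-! ### Comodule algebras -/

section Comodule

open Coalgebra WithConv

variable {R A B : Type u} [CommRing R] [CommRing A] [HopfAlgebra R A] [CommRing B] [Algebra R B]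
  {ρ : B →ₐ[R] B ⊗[R] A} {W W' : Type u} [CommRing W] [Algebra R W] [CommRing W'] [Algebra R W']

variable (ρ) in
/-- The action `(x, g) ↦ x · g` on `W`-valued points. -/
def act (x : B →ₐ[R] W) (g : WithConv (A →ₐ[R] W)) : B →ₐ[R] W :=
  (Algebra.TensorProduct.lift x g.ofConv (fun _ _ => Commute.all _ _)).comp ρ

lemma comp_act (h : W →ₐ[R] W') (x : B →ₐ[R] W) (g : WithConv (A →ₐ[R] W)) :
    h.comp (act ρ x g) = act ρ (h.comp x) (toConv (h.comp g.ofConv)) := by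
  rw [act, act, ← AlgHom.comp_assoc]
  congr 1
  ext <;> simp

lemma IsCoaction.act_mul (hρ : IsCoaction ρ) (x : B →ₐ[R] W) (g h : WithConv (A →ₐ[R] W)) :
    act ρ x (g * h) = act ρ (act ρ x g) h := by
  let l := Algebra.TensorProduct.lift x
    (Algebra.TensorProduct.lift g.ofConv h.ofConv (fun _ _ => Commute.all _ _))
    (fun _ _ => Commute.all _ _)
  have h1 : l.comp (Algebra.TensorProduct.map (AlgHom.id R B) (Bialgebra.comulAlgHom R A)) =
      Algebra.TensorProduct.lift x (g * h).ofConv (fun _ _ => Commute.all _ _) := by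
    ext a
    · simp [l]
    · simpa [l] using (AlgHom.convMul_apply g h a).symm
  have h2 : l.comp ((Algebra.TensorProduct.assoc R R R B A A : (B ⊗[R] A) ⊗[R] A →ₐ[R] _).comp
      (Algebra.TensorProduct.map ρ (AlgHom.id R A))) =
      Algebra.TensorProduct.lift (act ρ x g) h.ofConv (fun _ _ => Commute.all _ _) := by
    have h3 : l.comp (Algebra.TensorProduct.assoc R R R B A A : (B ⊗[R] A) ⊗[R] A →ₐ[R] _) =
        Algebra.TensorProduct.lift (Algebra.TensorProduct.lift x g.ofConv
          (fun _ _ => Commute.all _ _)) h.ofConv (fun _ _ => Commute.all _ _) := by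
      ext
      · simp [l]
      · simp [l]
      · simp [l, Algebra.TensorProduct.one_def]
    rw [← AlgHom.comp_assoc, h3]
    ext
    · simp [act]
    · simp
  rw [act, ← h1, act, ← h2, AlgHom.comp_assoc, AlgHom.comp_assoc, hρ.coassoc]

lemma IsCoaction.act_one (hρ : IsCoaction ρ) (x : B →ₐ[R] W) : act ρ x 1 = x := by
  have h1 : Algebra.TensorProduct.lift x (1 : WithConv (A →ₐ[R] W)).ofConv
      (fun _ _ => Commute.all _ _) =
      x.comp ((Algebra.TensorProduct.rid R R B : B ⊗[R] R →ₐ[R] B).comp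
      (Algebra.TensorProduct.map (AlgHom.id R B) (Bialgebra.counitAlgHom R A))) := by
    ext a
    · simp
    · simp [AlgHom.convOne_def, Algebra.ofId_apply, Algebra.algebraMap_eq_smul_one]
  rw [act, h1, AlgHom.comp_assoc, hρ.counit, AlgHom.comp_id]

variable (ρ) in
/-- The action `b ↦ b₀ f(b₁)` of functionals on a comodule. -/
def contract (f : A →ₗ[R] R) : B →ₗ[R] B :=
  (TensorProduct.rid R B).toLinearMap ∘ₗ f.lTensor B ∘ₗ ρ.toLinearMap

lemma IsCoaction.apply_contract (hρ : IsCoaction ρ) (f : A →ₗ[R] R) (b : B) :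
    ρ (contract ρ f b) = (rightContract f).lTensor B (ρ b) := by
  have h1 : (rightContract f).lTensor B (ρ b) =
      (TensorProduct.rid R A).toLinearMap.lTensor B ((f.lTensor A).lTensor B
        (Algebra.TensorProduct.map (AlgHom.id R B) (Bialgebra.comulAlgHom R A) (ρ b))) := by
    simp only [rightContract, LinearMap.lTensor_comp]
    rfl
  have h2 : ∀ z : B ⊗[R] A, (TensorProduct.rid R A).toLinearMap.lTensor B ((f.lTensor A).lTensor B
      (Algebra.TensorProduct.assoc R R R B A A
        (Algebra.TensorProduct.map ρ (AlgHom.id R A) z))) =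
      ρ ((TensorProduct.rid R B) (f.lTensor B z)) := by
    intro z
    induction z with
    | zero => simp
    | add x y hx hy => simp only [map_add, hx, hy]
    | tmul x y =>
      simp only [Algebra.TensorProduct.map_tmul, LinearMap.lTensor_tmul, TensorProduct.rid_tmul,
        map_smul, AlgHom.id_apply]
      generalize ρ x = w
      induction w with
      | zero => simp
      | add x y hx hy => simp only [map_add, hx, hy, TensorProduct.add_tmul, smul_add]
      | tmul a b => simp
  rw [h1]
  exact (h2 (ρ b)).symm.trans (congrArg (fun w => (TensorProduct.rid R A).toLinearMap.lTensor B
    ((f.lTensor A).lTensor B w)) (DFunLike.congr_fun hρ.coassoc b))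

/-- By coassociativity ρ(b₀ f(b₁)) = b₀ ⊗ b₁ f(b₂), and the integral property replaces b₁ f(b₂) by
f(b₁) 1. -/
lemma IsCoaction.contract_mem_invariants (hρ : IsCoaction ρ) {f : A →ₗ[R] R}
    (hf : IsIntegral f) (b : B) : contract ρ f b ∈ invariants ρ := by
  refine (AlgHom.mem_equalizer _ _ _).mpr ?_
  rw [hρ.apply_contract, contract]
  simp only [LinearMap.comp_apply]
  change _ = (TensorProduct.rid R B) (f.lTensor B (ρ b)) ⊗ₜ[R] (1 : A)
  generalize ρ b = z
  induction z with
  | zero => simp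
  | add x y hx hy => simp only [map_add, hx, hy, TensorProduct.add_tmul]
  | tmul x y => simp [hf y, Algebra.algebraMap_eq_smul_one, TensorProduct.smul_tmul]

/-- The `B`-linear extension `B ⊗ A → B` of a functional on `A`. -/
def extendFunctional (B : Type u) [CommRing B] [Algebra R B] (f : A →ₗ[R] R) : B ⊗[R] A →ₗ[B] B :=
  (TensorProduct.AlgebraTensorModule.rid R B B).toLinearMap ∘ₗ f.baseChange B

@[simp] lemma extendFunctional_tmul (f : A →ₗ[R] R) (b : B) (a : A) :
    extendFunctional B f (b ⊗ₜ a) = f a • b := by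
  simp [extendFunctional]

lemma contract_apply (f : A →ₗ[R] R) (b : B) : contract ρ f b = extendFunctional B f (ρ b) := rfl

lemma apply_coe_invariants (c : invariants ρ) : ρ c = (c : B) ⊗ₜ[R] (1 : A) := c.2

/-- The map `b ↦ b₀ f(b₁)` for an integral `f`, with values in the ring of invariants. -/
def IsCoaction.traceMap (hρ : IsCoaction ρ) {f : A →ₗ[R] R} (hf : IsIntegral f) :
    B →ₗ[invariants ρ] invariants ρ where
  toFun b := ⟨contract ρ f b, hρ.contract_mem_invariants hf b⟩
  map_add' x y := by ext; simp
  map_smul' c x := by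
    ext
    change contract ρ f (c * x) = c * contract ρ f x
    rw [contract_apply, map_mul, apply_coe_invariants, contract_apply]
    rw [show ∀ z : B ⊗[R] A, ((c : B) ⊗ₜ[R] (1 : A)) * z = (c : B) • z from fun z => by
      rw [Algebra.smul_def]; rfl]
    simp

variable (ρ) in
/-- The image of the Galois map `x ⊗ y ↦ x ρ(y)`. -/
def galoisImage : Submodule B (B ⊗[R] A) := Submodule.span B (Set.range ρ)

variable (ρ) in
/-- The ideal of the elements which multiply `B ⊗ A` into the image of the Galois map: it defines
the closed subset of `Spec B` over which the action is not free. -/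
def freeIdeal : Ideal B := Module.annihilator B ((B ⊗[R] A) ⧸ galoisImage ρ)

lemma mem_freeIdeal {s : B} : s ∈ freeIdeal ρ ↔ ∀ z, s • z ∈ galoisImage ρ := by
  rw [freeIdeal, Module.mem_annihilator, (Submodule.mkQ_surjective _).forall]
  simp [← Submodule.Quotient.mk_smul, Submodule.Quotient.mk_eq_zero]

lemma mem_freeIdeal_of_tmul {s : B} (h : ∀ a : A, s ⊗ₜ[R] a ∈ galoisImage ρ) :
    s ∈ freeIdeal ρ := by
  rw [mem_freeIdeal]
  intro z
  induction z with
  | zero => simp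
  | add x y hx hy => rw [smul_add]; exact add_mem hx hy
  | tmul x y =>
    rw [show s • x ⊗ₜ[R] y = x • (s ⊗ₜ[R] y) by simp [TensorProduct.smul_tmul', mul_comm]]
    exact Submodule.smul_mem _ _ (h y)

/-! ### Stability of the non-free locus under the action -/

section Stable

variable (ρ) in
/-- The elements of `(B ⊗ A) ⊗ A` all of whose slices lie in the image of the Galois map. -/
def SlicesMem (w : (B ⊗[R] A) ⊗[R] A) : Prop :=
  ∀ f : A →ₗ[R] R, TensorProduct.rid R _ (f.lTensor _ w) ∈ galoisImage ρ

variable (R A B) in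
/-- The inclusion of functions of the first and the third variable. -/
def inclFstThd : B ⊗[R] A →ₐ[R] (B ⊗[R] A) ⊗[R] A :=
  Algebra.TensorProduct.map Algebra.TensorProduct.includeLeft (AlgHom.id R A)

/-- View (B ⊗ A) ⊗ A as functions of (x, g, h), sliced along h. The factor depending on h is
absorbed into the slicing functional, and the one depending on x is a scalar from B. -/
lemma SlicesMem.mul {w : (B ⊗[R] A) ⊗[R] A} (hw : SlicesMem ρ w) (z : B ⊗[R] A) :
    SlicesMem ρ (inclFstThd R A B z * w) := by
  induction z with
  | zero => intro f; simp
  | add x y hx hy => intro f; rw [map_add, add_mul, map_add, map_add]; exact add_mem (hx f) (hy f)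
  | tmul b a =>
    intro f
    have : TensorProduct.rid R _ (f.lTensor _ (inclFstThd R A B (b ⊗ₜ a) * w)) =
        b • TensorProduct.rid R _ ((f ∘ₗ LinearMap.mulLeft R a).lTensor _ w) := by
      clear hw
      induction w with
      | zero => simp
      | add x y hx hy => simp only [mul_add, map_add, smul_add, hx, hy]
      | tmul m a' =>
        simp [inclFstThd, smul_comm b, Algebra.smul_def b]
    rw [this]
    exact Submodule.smul_mem _ _ (hw _)

lemma slicesMem_includeLeft {m : B ⊗[R] A} (hm : m ∈ galoisImage ρ) :
    SlicesMem ρ (m ⊗ₜ (1 : A)) := by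
  intro f
  have : TensorProduct.rid R _ (f.lTensor _ (m ⊗ₜ[R] (1 : A))) = algebraMap R B (f 1) • m := by
    rw [algebraMap_smul, LinearMap.lTensor_tmul, TensorProduct.rid_tmul]
  rw [this]
  exact Submodule.smul_mem _ _ hm

variable (R A B) in
/-- The inverse of the third variable. -/
def divPoint : WithConv (A →ₐ[R] (B ⊗[R] A) ⊗[R] A) :=
  inversePoint (toConv Algebra.TensorProduct.includeRight) *
    toConv ((Algebra.TensorProduct.includeLeft : B ⊗[R] A →ₐ[R] (B ⊗[R] A) ⊗[R] A).comp
      Algebra.TensorProduct.includeRight)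

variable (ρ) in
/-- The substitution `(x, g) ↦ (x h, h⁻¹ g)`. -/
def translate : B ⊗[R] A →ₐ[R] (B ⊗[R] A) ⊗[R] A :=
  Algebra.TensorProduct.lift ((inclFstThd R A B).comp ρ) (divPoint R A B).ofConv
    (fun _ _ => Commute.all _ _)

lemma inclFstThd_comp_eq_act : (inclFstThd R A B).comp ρ =
    act ρ ((Algebra.TensorProduct.includeLeft : B ⊗[R] A →ₐ[R] (B ⊗[R] A) ⊗[R] A).comp
      Algebra.TensorProduct.includeLeft) (toConv Algebra.TensorProduct.includeRight) := by
  rw [act]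
  congr 1
  ext <;> simp [inclFstThd, Algebra.TensorProduct.one_def]

lemma comp_eq_act (l : B ⊗[R] A →ₐ[R] W) : l.comp ρ =
    act ρ (l.comp Algebra.TensorProduct.includeLeft)
      (toConv (l.comp Algebra.TensorProduct.includeRight)) := by
  rw [act]
  congr 1
  ext <;> simp

/-- The function ρ(b) is (x, g) ↦ b(x g), and (x h)(h⁻¹ g) = x g. -/
lemma IsCoaction.translate_apply (hρ : IsCoaction ρ) (b : B) :
    translate ρ (ρ b) = ρ b ⊗ₜ (1 : A) := by
  have : (translate ρ).comp ρ = (Algebra.TensorProduct.includeLeft :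
      B ⊗[R] A →ₐ[R] (B ⊗[R] A) ⊗[R] A).comp ρ := by
    rw [comp_eq_act (ρ := ρ) (Algebra.TensorProduct.includeLeft :
      B ⊗[R] A →ₐ[R] (B ⊗[R] A) ⊗[R] A), translate]
    refine (show _ = act ρ ((inclFstThd R A B).comp ρ) (divPoint R A B) from rfl).trans ?_
    rw [inclFstThd_comp_eq_act, ← hρ.act_mul, divPoint, mul_inversePoint_cancel_left]
  exact DFunLike.congr_fun this b

lemma translate_smul (b : B) (z : B ⊗[R] A) :
    translate ρ (b • z) = inclFstThd R A B (ρ b) * translate ρ z := by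
  have : b • z = (b ⊗ₜ[R] (1 : A)) * z := by rw [Algebra.smul_def]; rfl
  rw [this, map_mul]
  simp [translate]

lemma IsCoaction.slicesMem_translate (hρ : IsCoaction ρ) {m : B ⊗[R] A}
    (hm : m ∈ galoisImage ρ) : SlicesMem ρ (translate ρ m) := by
  induction hm using Submodule.span_induction with
  | mem m hm =>
    obtain ⟨b, rfl⟩ := hm
    rw [hρ.translate_apply]
    exact slicesMem_includeLeft (Submodule.subset_span ⟨b, rfl⟩)
  | zero => intro f; simp
  | add x y _ _ hx hy => intro f; rw [map_add, map_add, map_add]; exact add_mem (hx f) (hy f)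
  | smul b m _ h => rw [translate_smul]; exact h.mul _

/-- The non-free locus is stable under the action. -/
lemma IsCoaction.contract_mem_freeIdeal (hρ : IsCoaction ρ) {s : B} (hs : s ∈ freeIdeal ρ)
    (f : A →ₗ[R] R) : contract ρ f s ∈ freeIdeal ρ := by
  refine mem_freeIdeal_of_tmul fun a => ?_
  -- For z = a₁ ⊗ a₂ the function is s(x h) a₁(h) a₂(h⁻¹ g): the translate of s ⊗ a₂, which lies in
  -- the Galois image, times a function of h.
  have key : ∀ z : A ⊗[R] A, SlicesMem ρ (inclFstThd R A B (ρ s) *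
      Algebra.TensorProduct.lift (Algebra.TensorProduct.includeRight : A →ₐ[R] _)
        (divPoint R A B).ofConv (fun _ _ => Commute.all _ _) z) := by
    intro z
    induction z with
    | zero => intro f; simp
    | add x y hx hy =>
      intro f
      rw [map_add, mul_add, map_add, map_add]
      exact add_mem (hx f) (hy f)
    | tmul x y =>
      have h1 : s ⊗ₜ[R] y ∈ galoisImage ρ := by
        simpa [TensorProduct.smul_tmul'] using mem_freeIdeal.mp hs (1 ⊗ₜ y)
      have h2 := (hρ.slicesMem_translate h1).mul (1 ⊗ₜ x)
      convert h2 using 1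
      simp only [translate, Algebra.TensorProduct.lift_tmul, inclFstThd,
        Algebra.TensorProduct.map_tmul, AlgHom.id_apply, map_one, AlgHom.comp_apply,
        Algebra.TensorProduct.includeRight_apply]
      ring
  -- For z = Δ(a) the last two factors combine to a(h · h⁻¹ g) = a(g), so slicing with f gives
  -- `contract ρ f s` ⊗ a.
  have h3 : Algebra.TensorProduct.lift (Algebra.TensorProduct.includeRight : A →ₐ[R] _)
      (divPoint R A B).ofConv (fun _ _ => Commute.all _ _) (comul a) =
      ((1 : B) ⊗ₜ[R] a) ⊗ₜ[R] (1 : A) := by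
    have := AlgHom.convMul_apply (toConv (Algebra.TensorProduct.includeRight :
      A →ₐ[R] (B ⊗[R] A) ⊗[R] A)) (divPoint R A B) a
    rw [divPoint, mul_inversePoint_cancel_left] at this
    exact this.symm
  have h4 := key (comul a) f
  rw [h3] at h4
  convert h4 using 1
  rw [contract_apply]
  generalize ρ s = z
  induction z with
  | zero => simp
  | add x y hx hy => simp only [map_add, add_mul, TensorProduct.add_tmul, hx, hy]
  | tmul x y => simp [inclFstThd, TensorProduct.smul_tmul']

end Stable

/-! ### The Galois map away from the zeros of the free ideal -/

section FreeLocus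

/-- Dual-basis formula for the multiplication by an element of the free ideal. -/
lemma IsCoaction.exists_formula [Module.Finite R A] [Module.Projective R A] (hρ : IsCoaction ρ)
    {s : B} (hs : s ∈ freeIdeal ρ) :
    ∃ (ι : Type) (_ : Fintype ι) (a b : ι → B) (l : ι → A →ₗ[R] R), (∀ i, IsIntegral (l i)) ∧
      ∀ y, s * y = ∑ i, a i * contract ρ (l i) (b i * y) := by
  obtain ⟨n, l, t, hl, hlt⟩ := exists_integrals R A
  -- As s ∈ F, each s ⊗ t_j is a combination ∑ a_i ρ(b_i); the a_i and b_i are the required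
  -- coefficients.
  choose m a b' h using fun j => Submodule.mem_span_set'.mp (mem_freeIdeal.mp hs (1 ⊗ₜ t j))
  choose b hb using fun j i => (b' j i).2
  simp only [← hb] at h
  refine ⟨Σ j, Fin (m j), inferInstance, fun p => a p.1 p.2, fun p => b p.1 p.2, fun p => l p.1,
    fun p => hl _, fun y => ?_⟩
  -- Decomposition of id ⊗ ε into integrals; at z = ρ(y) the counit axiom makes it a formula for y.
  have h1 : ∀ z : B ⊗[R] A, ∑ j, extendFunctional B (l j) ((1 ⊗ₜ t j) * z) =
      (Algebra.TensorProduct.rid R R B) (Algebra.TensorProduct.map (AlgHom.id R B)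
        (Bialgebra.counitAlgHom R A) z) := by
    intro z
    induction z with
    | zero => simp
    | add x y hx hy => simp only [map_add, mul_add, Finset.sum_add_distrib, hx, hy]
    | tmul x y => simp [← hlt y, Finset.sum_smul]
  have h2 := h1 (ρ y)
  have h3 : _ = y := DFunLike.congr_fun hρ.counit y
  replace h2 := h2.trans h3
  rw [Fintype.sum_sigma]
  conv_lhs => rw [← h2, Finset.mul_sum]
  refine Finset.sum_congr rfl fun j _ => ?_
  rw [← smul_eq_mul, ← map_smul, ← smul_mul_assoc, ← h j, Finset.sum_mul, map_sum]
  refine Finset.sum_congr rfl fun i _ => ?_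
  rw [smul_mul_assoc, map_smul, ← map_mul, smul_eq_mul, contract_apply]

/-- The free ideal is not contained in the prime ideal of a point as soon as its intersection with
the ring of invariants is not. -/
lemma IsCoaction.exists_invariant [Module.Finite R A] [Module.Projective R A] (hρ : IsCoaction ρ)
    {P : Ideal B} [P.IsPrime] (hP : ¬ freeIdeal ρ ≤ P) :
    ∃ c : invariants ρ, (c : B) ∈ freeIdeal ρ ∧ (c : B) ∉ P := by
  obtain ⟨s, hs, hsP⟩ := SetLike.not_le_iff_exists.mp hP
  obtain ⟨ι, _, a, b, l, hl, h⟩ := hρ.exists_formula hs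
  by_contra! hcon
  -- Taking y = s makes every trace in the formula a contraction of b_i s ∈ F, hence an element of F
  -- ∩ C.
  have h1 := h s
  have h2 : s * s ∈ P := by
    rw [h1]
    refine sum_mem fun i _ => P.mul_mem_left _ ?_
    exact hcon ⟨_, hρ.contract_mem_invariants (hl i) _⟩
      (hρ.contract_mem_freeIdeal (Ideal.mul_mem_left _ _ hs) _)
  exact hsP ((Ideal.IsPrime.mem_or_mem ‹_› h2).elim id id)

variable (ρ) in
/-- The coaction as a morphism of algebras over the ring of invariants. -/
def coactionOverInvariants : B →ₐ[invariants ρ] B ⊗[R] A where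
  __ := ρ.toRingHom
  commutes' c := c.2

variable (ρ) in
/-- The Galois map `x ⊗ y ↦ x ρ(y)`. -/
def galoisMap : B ⊗[invariants ρ] B →+* B ⊗[R] A :=
  RingHomClass.toRingHom (Algebra.TensorProduct.lift
    (IsScalarTower.toAlgHom (invariants ρ) B (B ⊗[R] A))
    (coactionOverInvariants ρ) (fun _ _ => Commute.all _ _))

lemma galoisMap_tmul (x y : B) : galoisMap ρ (x ⊗ₜ y) = x • ρ y := by
  refine (Algebra.TensorProduct.lift_tmul _ _ (fun _ _ => Commute.all _ _) x y).trans ?_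
  rw [Algebra.smul_def]
  rfl

lemma mem_range_galoisMap {z : B ⊗[R] A} (hz : z ∈ galoisImage ρ) :
    ∃ w, galoisMap ρ w = z := by
  induction hz using Submodule.span_induction with
  | mem m hm =>
    obtain ⟨b, rfl⟩ := hm
    exact ⟨1 ⊗ₜ b, by rw [galoisMap_tmul, one_smul]⟩
  | zero => exact ⟨0, map_zero _⟩
  | add x y _ _ hx hy =>
    obtain ⟨v, rfl⟩ := hx
    obtain ⟨w, rfl⟩ := hy
    exact ⟨v + w, map_add _ _ _⟩
  | smul b m _ h =>
    obtain ⟨w, rfl⟩ := h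
    refine ⟨(b ⊗ₜ 1) * w, ?_⟩
    rw [map_mul, galoisMap_tmul, map_one, smul_mul_assoc, one_mul]

/-- Moving the traces in c y = ∑ tr_i(b_i y) a_i across the tensor sign expresses (c ⊗ 1) z through
the Galois image of z alone. -/
lemma IsCoaction.mul_eq_zero_of_galoisMap [Module.Finite R A] [Module.Projective R A]
    (hρ : IsCoaction ρ) {c : invariants ρ} (hc : (c : B) ∈ freeIdeal ρ)
    {z : B ⊗[invariants ρ] B} (hz : galoisMap ρ z = 0) : ((c : B) ⊗ₜ 1) * z = 0 := by
  obtain ⟨ι, _, a, b, l, hl, h⟩ := hρ.exists_formula hc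
  have key : ∀ z : B ⊗[invariants ρ] B, ((c : B) ⊗ₜ 1) * z =
      ∑ i, (extendFunctional B (l i) (ρ (b i) * galoisMap ρ z)) ⊗ₜ[invariants ρ] a i := by
    intro z
    induction z with
    | zero => simp
    | add x y hx hy =>
      simp only [map_add, mul_add, TensorProduct.add_tmul, Finset.sum_add_distrib, hx, hy]
    | tmul x y =>
      have h1 : c • y = ∑ i, hρ.traceMap (hl i) (b i * y) • a i := by
        refine (h y).trans (Finset.sum_congr rfl fun i _ => mul_comm _ _)
      have h2 : ((c : B) ⊗ₜ[invariants ρ] (1 : B)) * (x ⊗ₜ y) = x ⊗ₜ (c • y) := by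
        rw [Algebra.TensorProduct.tmul_mul_tmul, one_mul, ← TensorProduct.smul_tmul]
        rfl
      rw [h2, h1, TensorProduct.tmul_sum]
      refine Finset.sum_congr rfl fun i _ => ?_
      rw [← TensorProduct.smul_tmul]
      congr 1
      rw [galoisMap_tmul, mul_smul_comm, ← map_mul, map_smul, smul_eq_mul, ← contract_apply]
      exact mul_comm _ _
  rw [key z, hz]
  simp

/-- Lifting along a ring homomorphism which is an isomorphism away from `c`. -/
lemma exists_lift_of_away {P Q W : Type*} [CommRing P] [CommRing Q] [CommRing W] (f : P →+* Q)
    (c : P) (h1 : ∀ q, ∃ p, f p = f c * q) (h2 : ∀ p, f p = 0 → c * p = 0) (h : P →+* W)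
    (hc : IsUnit (h c)) : ∃ k : Q →+* W, k.comp f = h := by
  choose σ hσ using h1
  have hker : ∀ p, f p = 0 → h p = 0 := fun p hp => by
    have := congrArg h (h2 p hp)
    rwa [map_mul, map_zero, hc.mul_right_eq_zero] at this
  have hext : ∀ p q, f p = f q → h p = h q := fun p q hpq => by
    rw [← sub_eq_zero, ← map_sub]
    exact hker _ (by rw [map_sub, hpq, sub_self])
  obtain ⟨u, hu⟩ := hc
  have key : ∀ p q, f p = f c * q → h (σ q) = h p := fun p q hpq => hext _ _ (by rw [hσ, hpq])
  -- The value at q is h(p) / h(c) for any p with f p = f c * q; by `key` it does not depend on p.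
  let k : Q → W := fun q => ↑u⁻¹ * h (σ q)
  refine ⟨{ toFun := k, map_one' := ?_, map_mul' := ?_, map_zero' := ?_, map_add' := ?_ }, ?_⟩
  · simp only [k]
    rw [key c 1 (mul_one _).symm, ← hu, Units.inv_mul]
  · intro x y
    have : h c * h (σ (x * y)) = h (σ x) * h (σ y) := by
      rw [← map_mul, ← map_mul]
      refine hext _ _ ?_
      rw [map_mul, map_mul, hσ, hσ, hσ]
      ring
    simp only [k]
    rw [← hu] at this
    have h3 : h (σ (x * y)) = ↑u⁻¹ * (h (σ x) * h (σ y)) := by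
      rw [← this, Units.inv_mul_cancel_left]
    rw [h3]
    ring
  · simp only [k]
    rw [key 0 0 (by simp), map_zero, mul_zero]
  · intro x y
    simp only [k]
    rw [key (σ x + σ y) (x + y) (by rw [map_add, hσ, hσ, mul_add]), map_add, mul_add]
  · ext p
    change ↑u⁻¹ * h (σ (f p)) = h p
    rw [key (c * p) (f p) (map_mul _ _ _), map_mul, ← hu, Units.inv_mul_cancel_left]

/-- Over the free locus, two points with the same invariants differ by a point of the group. -/
lemma IsCoaction.exists_act_eq [Module.Finite R A] [Module.Projective R A]
    (hρ : IsCoaction ρ) {c : invariants ρ} (hc : (c : B) ∈ freeIdeal ρ) (x y : B →ₐ[R] W)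
    (hxy : ∀ b : invariants ρ, x b = y b) (hcu : IsUnit (x c)) :
    ∃ g : WithConv (A →ₐ[R] W), act ρ x g = y := by
  let _ : Algebra (invariants ρ) W := (x.comp (invariants ρ).val).toRingHom.toAlgebra
  let x' : B →ₐ[invariants ρ] W := { x.toRingHom with commutes' := fun _ => rfl }
  let y' : B →ₐ[invariants ρ] W := { y.toRingHom with commutes' := fun b => (hxy b).symm }
  let h : B ⊗[invariants ρ] B →+* W := RingHomClass.toRingHom
    (Algebra.TensorProduct.lift x' y' (fun _ _ => Commute.all _ _))
  have hh : ∀ a b, h (a ⊗ₜ b) = x a * y b := fun a b =>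
    Algebra.TensorProduct.lift_tmul x' y' (fun _ _ => Commute.all _ _) a b
  -- The pair (x, y) is a homomorphism B ⊗_C B → W. It factors through the Galois map because c
  -- becomes invertible in W; restricting the factor to A gives g.
  obtain ⟨k, hk⟩ := exists_lift_of_away (galoisMap ρ) ((c : B) ⊗ₜ 1)
    (fun q => by
      obtain ⟨w, hw⟩ := mem_range_galoisMap (mem_freeIdeal.mp hc q)
      refine ⟨w, hw.trans ?_⟩
      rw [galoisMap_tmul, map_one, smul_mul_assoc, one_mul])
    (fun p hp => hρ.mul_eq_zero_of_galoisMap hc hp) h (by simpa [hh] using hcu)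
  have hk1 : ∀ b, k (b ⊗ₜ 1) = x b := fun b => by
    have := RingHom.congr_fun hk (b ⊗ₜ 1)
    simpa [hh, galoisMap_tmul, TensorProduct.smul_tmul', Algebra.TensorProduct.one_def] using this
  have hk2 : ∀ b, k (ρ b) = y b := fun b => by
    have := RingHom.congr_fun hk (1 ⊗ₜ b)
    simpa [hh, galoisMap_tmul] using this
  let k' : B ⊗[R] A →ₐ[R] W := { k with
    commutes' := fun r => by
      have := hk1 (algebraMap R B r)
      rw [AlgHom.commutes] at this
      exact this }
  refine ⟨toConv (k'.comp Algebra.TensorProduct.includeRight), ?_⟩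
  have : k'.comp Algebra.TensorProduct.includeLeft = x := AlgHom.ext hk1
  rw [← this, ← comp_eq_act]
  exact AlgHom.ext hk2

/-- Over the free locus, points of the group act freely. -/
lemma act_injective {c : B} (hc : c ∈ freeIdeal ρ) (x : B →ₐ[R] W) (hcu : IsUnit (x c))
    {g h : WithConv (A →ₐ[R] W)} (hgh : act ρ x g = act ρ x h) : g = h := by
  -- Both homomorphisms restrict to x on B and agree on ρ(B), hence on its B-span, which contains
  -- all c ⊗ a.
  have key : ∀ z ∈ galoisImage ρ,
      Algebra.TensorProduct.lift x g.ofConv (fun _ _ => Commute.all _ _) z =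
      Algebra.TensorProduct.lift x h.ofConv (fun _ _ => Commute.all _ _) z := by
    intro z hz
    induction hz using Submodule.span_induction with
    | mem m hm =>
      obtain ⟨b, rfl⟩ := hm
      exact DFunLike.congr_fun hgh b
    | zero => simp
    | add x y _ _ hx hy => rw [map_add, map_add, hx, hy]
    | smul b m _ h =>
      have : b • m = (b ⊗ₜ[R] (1 : A)) * m := by rw [Algebra.smul_def]; rfl
      rw [this, map_mul, map_mul, h]
      simp
  ext a
  have := key _ (mem_freeIdeal.mp hc (1 ⊗ₜ a))
  simp only [TensorProduct.smul_tmul', smul_eq_mul, mul_one,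
    Algebra.TensorProduct.lift_tmul] at this
  exact hcu.mul_left_cancel this

end FreeLocus

end Comodule

section Comodule

open Coalgebra WithConv

variable {R A B : Type u} [CommRing R] [CommRing A] [HopfAlgebra R A] [CommRing B] [Algebra R B]
  {ρ : B →ₐ[R] B ⊗[R] A}

/-! ### B is finite projective over C where a free invariant is inverted -/

section Localization

variable [Module.Finite R A] [Module.Projective R A]

/-- The coordinates of f are the traces y ↦ tr_i(b_i y), and g is given by the coefficients a_i of
the formula for c y. -/
lemma IsCoaction.exists_factorization (hρ : IsCoaction ρ) {c : invariants ρ}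
    (hc : (c : B) ∈ freeIdeal ρ) :
    ∃ (ι : Type) (_ : Fintype ι) (f : B →ₗ[invariants ρ] (ι → invariants ρ))
      (g : (ι → invariants ρ) →ₗ[invariants ρ] B), g ∘ₗ f = c • LinearMap.id := by
  obtain ⟨ι, _, a, b, l, hl, h⟩ := hρ.exists_formula hc
  refine ⟨ι, inferInstance,
    LinearMap.pi fun i => hρ.traceMap (hl i) ∘ₗ LinearMap.mulLeft (invariants ρ) (b i),
    Fintype.linearCombination (invariants ρ) a, ?_⟩
  ext y
  simp only [LinearMap.comp_apply, Fintype.linearCombination_apply, LinearMap.pi_apply,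
    LinearMap.smul_apply, LinearMap.id_apply]
  exact ((h y).trans (Finset.sum_congr rfl fun i _ => mul_comm _ _)).symm

/-- Dividing the factorization of multiplication by c by the unit c splits B_c off a free module. -/
lemma IsCoaction.exists_section (hρ : IsCoaction ρ) {c : invariants ρ}
    (hc : (c : B) ∈ freeIdeal ρ) (L : Type u) [CommRing L] [Algebra (invariants ρ) L]
    [IsLocalization.Away c L] :
    ∃ (ι : Type) (_ : Fintype ι)
      (f : L ⊗[invariants ρ] B →ₗ[L] L ⊗[invariants ρ] (ι → invariants ρ))
      (g : L ⊗[invariants ρ] (ι → invariants ρ) →ₗ[L] L ⊗[invariants ρ] B),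
      g ∘ₗ f = LinearMap.id := by
  obtain ⟨ι, _, f, g, h⟩ := hρ.exists_factorization hc
  obtain ⟨u, hu⟩ := IsLocalization.Away.algebraMap_isUnit (S := L) c
  refine ⟨ι, inferInstance, f.baseChange L, (↑u⁻¹ : L) • g.baseChange L, ?_⟩
  rw [LinearMap.smul_comp, ← LinearMap.baseChange_comp, h]
  refine LinearMap.ext fun z => ?_
  induction z with
  | zero => simp
  | add y z hy hz => rw [map_add, map_add, hy, hz]
  | tmul k y =>
    have : k ⊗ₜ[invariants ρ] (c • y) = (u : L) • (k ⊗ₜ y) := by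
      rw [← TensorProduct.smul_tmul, hu, TensorProduct.smul_tmul', Algebra.smul_def, smul_eq_mul]
    rw [LinearMap.smul_apply, LinearMap.baseChange_tmul, LinearMap.smul_apply, LinearMap.id_apply,
      this, smul_smul, Units.inv_mul, one_smul, LinearMap.id_apply]

lemma IsCoaction.finite_away (hρ : IsCoaction ρ) {c : invariants ρ}
    (hc : (c : B) ∈ freeIdeal ρ) (L : Type u) [CommRing L] [Algebra (invariants ρ) L]
    [IsLocalization.Away c L] : Module.Finite L (L ⊗[invariants ρ] B) := by
  obtain ⟨ι, _, f, g, h⟩ := hρ.exists_section hc L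
  exact Module.Finite.of_surjective g fun y => ⟨f y, LinearMap.congr_fun h y⟩

lemma IsCoaction.projective_away (hρ : IsCoaction ρ) {c : invariants ρ}
    (hc : (c : B) ∈ freeIdeal ρ) (L : Type u) [CommRing L] [Algebra (invariants ρ) L]
    [IsLocalization.Away c L] : Module.Projective L (L ⊗[invariants ρ] B) := by
  obtain ⟨ι, _, f, g, h⟩ := hρ.exists_section hc L
  exact Module.Projective.of_split f g h

end Localization

/-! ### Trivial stabilizers and the free ideal -/

section Stabilizer

variable {K : Type u} [Field K] [Algebra R K]

variable (ρ) in
/-- The stabilizer of a point is trivial. -/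
def StabilizerTrivial (x : B →ₐ[R] K) : Prop :=
  ∀ (W : Type u) [CommRing W] [Algebra R W] (i : K →ₐ[R] W) (g : WithConv (A →ₐ[R] W)),
    act ρ (i.comp x) g = i.comp x → g = 1

variable (ρ) in
/-- The comorphism of the orbit map `g ↦ x · g`. -/
def orbitMap (x : B →ₐ[R] K) : K ⊗[R] B →ₐ[K] K ⊗[R] A :=
  Algebra.TensorProduct.lift (Algebra.ofId K _)
    (act ρ ((Algebra.TensorProduct.includeLeft : K →ₐ[R] K ⊗[R] A).comp x)
      (toConv Algebra.TensorProduct.includeRight)) (fun _ _ => Commute.all _ _)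

/-- A trivial stabilizer makes the orbit map a monomorphism of affine schemes, so its comorphism is
an epimorphism of rings. It is finite since its target is finite over K, and finite epimorphisms are
surjective. -/
lemma orbitMap_surjective [Module.Finite R A] (hρ : IsCoaction ρ) {x : B →ₐ[R] K}
    (hx : StabilizerTrivial ρ x) : Function.Surjective (orbitMap ρ x) := by
  have hepi : Epi (CommRingCat.ofHom (orbitMap ρ x).toRingHom) := by
    refine ⟨fun {Z} g1 g2 hg => ?_⟩
    have hg' : ∀ z, g1.hom (orbitMap ρ x z) = g2.hom (orbitMap ρ x z) := fun z =>
      congrArg (fun k : CommRingCat.of (K ⊗[R] B) ⟶ Z => k.hom z) hg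
    let _ : Algebra R Z := (g1.hom.comp (algebraMap R (K ⊗[R] A))).toAlgebra
    let G1 : K ⊗[R] A →ₐ[R] Z := { g1.hom with commutes' := fun _ => rfl }
    let G2 : K ⊗[R] A →ₐ[R] Z := { g2.hom with
      commutes' := fun r => by
        have := hg' (algebraMap R _ r)
        rw [AlgHom.map_algebraMap (orbitMap ρ x)] at this
        exact this.symm }
    have hG : ∀ z, G1 (orbitMap ρ x z) = G2 (orbitMap ρ x z) := hg'
    have hl : G1.comp Algebra.TensorProduct.includeLeft =
        G2.comp Algebra.TensorProduct.includeLeft := by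
      ext k
      simpa [orbitMap, Algebra.ofId_apply] using hG (k ⊗ₜ 1)
    have hr : act ρ ((G1.comp Algebra.TensorProduct.includeLeft).comp x)
        (toConv (G1.comp Algebra.TensorProduct.includeRight)) =
        act ρ ((G1.comp Algebra.TensorProduct.includeLeft).comp x)
        (toConv (G2.comp Algebra.TensorProduct.includeRight)) := by
      conv_rhs => rw [hl]
      rw [AlgHom.comp_assoc, AlgHom.comp_assoc]
      have e1 := comp_act (ρ := ρ) G1
        ((Algebra.TensorProduct.includeLeft : K →ₐ[R] K ⊗[R] A).comp x)
        (toConv Algebra.TensorProduct.includeRight)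
      have e2 := comp_act (ρ := ρ) G2
        ((Algebra.TensorProduct.includeLeft : K →ₐ[R] K ⊗[R] A).comp x)
        (toConv Algebra.TensorProduct.includeRight)
      refine e1.symm.trans (Eq.trans ?_ e2)
      ext b
      simpa [orbitMap, ← Algebra.TensorProduct.one_def] using hG (1 ⊗ₜ b)
    -- If x · g₁ = x · g₂ then g₁ g₂⁻¹ stabilizes x.
    have h1 := hx Z (G1.comp Algebra.TensorProduct.includeLeft)
      (toConv (G1.comp Algebra.TensorProduct.includeRight) *
        inversePoint (toConv (G2.comp Algebra.TensorProduct.includeRight))) (by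
      rw [hρ.act_mul, hr, ← hρ.act_mul, self_mul_inversePoint, hρ.act_one])
    have h2 : G1.comp Algebra.TensorProduct.includeRight =
        G2.comp Algebra.TensorProduct.includeRight := by
      have := congrArg (· * toConv (G2.comp Algebra.TensorProduct.includeRight)) h1
      simp only [mul_assoc, inversePoint_mul_self, mul_one, one_mul] at this
      exact congrArg ofConv this
    have h3 : G1 = G2 := Algebra.TensorProduct.ext hl h2
    exact CommRingCat.hom_ext (RingHom.ext fun z => DFunLike.congr_fun h3 z)
  refine RingHom.surjective_of_epi_of_finite (CommRingCat.ofHom (orbitMap ρ x).toRingHom) ?_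
  refine RingHom.Finite.of_comp_finite (f := algebraMap K (K ⊗[R] B)) ?_
  rw [show (CommRingCat.ofHom (orbitMap ρ x).toRingHom).hom.comp (algebraMap K (K ⊗[R] B)) =
    algebraMap K (K ⊗[R] A) from (orbitMap ρ x).comp_algebraMap]
  exact RingHom.finite_algebraMap.mpr inferInstance

/-- The fibre at x of the cokernel of the Galois map is a quotient of K ⊗ A in which the image of
the orbit map dies. -/
lemma subsingleton_fiber {x : B →ₐ[R] K} (h : Function.Surjective (orbitMap ρ x)) :
    letI := x.toRingHom.toAlgebra
    Subsingleton (K ⊗[B] ((B ⊗[R] A) ⧸ galoisImage ρ)) := by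
  let _ := x.toRingHom.toAlgebra
  have : IsScalarTower R B K := IsScalarTower.of_algebraMap_eq fun r => (x.commutes r).symm
  let N := (B ⊗[R] A) ⧸ galoisImage ρ
  let j : A →ₗ[R] K ⊗[B] N := ((TensorProduct.mk B K N 1).restrictScalars R) ∘ₗ
    ((galoisImage ρ).mkQ.restrictScalars R) ∘ₗ TensorProduct.mk R B A 1
  let Ψ : K ⊗[R] A →ₗ[K] K ⊗[B] N := TensorProduct.AlgebraTensorModule.lift
    { toFun := fun k => k • j
      map_add' := fun a b => by simp [add_smul]
      map_smul' := fun a b => by simp [mul_smul] }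
  have hΨ : ∀ k a, Ψ (k ⊗ₜ a) = k ⊗ₜ[B] (galoisImage ρ).mkQ (1 ⊗ₜ a) := fun k a => by
    simp [Ψ, j, TensorProduct.smul_tmul']
  have h0 : ∀ z : B ⊗[R] A, Ψ (Algebra.TensorProduct.map x (AlgHom.id R A) z) =
      (1 : K) ⊗ₜ[B] (galoisImage ρ).mkQ z := by
    intro z
    induction z with
    | zero => simp
    | add y z hy hz => rw [map_add, map_add, hy, hz, map_add, TensorProduct.tmul_add]
    | tmul b a =>
      rw [Algebra.TensorProduct.map_tmul, AlgHom.id_apply, hΨ,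
        show b ⊗ₜ[R] a = b • ((1 : B) ⊗ₜ[R] a) by simp [TensorProduct.smul_tmul'], map_smul,
        ← TensorProduct.smul_tmul, Algebra.smul_def, mul_one]
      rfl
  have h1 : ∀ b, Ψ (orbitMap ρ x (1 ⊗ₜ b)) = 0 := by
    intro b
    have : orbitMap ρ x (1 ⊗ₜ b) = Algebra.TensorProduct.map x (AlgHom.id R A) (ρ b) := by
      rw [orbitMap, Algebra.TensorProduct.lift_tmul, map_one, one_mul, act, AlgHom.comp_apply]
      congr 1
      ext <;> simp
    have hb : (galoisImage ρ).mkQ (ρ b) = 0 :=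
      (Submodule.Quotient.mk_eq_zero _).mpr (Submodule.subset_span ⟨b, rfl⟩)
    rw [this, h0, hb, TensorProduct.tmul_zero]
  have h2 : ∀ z, Ψ (orbitMap ρ x z) = 0 := by
    intro z
    induction z with
    | zero => simp
    | add y z hy hz => rw [map_add, map_add, hy, hz, add_zero]
    | tmul k b =>
      rw [show k ⊗ₜ[R] b = k • ((1 : K) ⊗ₜ[R] b) by simp [TensorProduct.smul_tmul'], map_smul,
        map_smul, h1, smul_zero]
  refine subsingleton_of_forall_eq 0 fun z => ?_
  induction z with
  | zero => rfl
  | add y z hy hz => rw [hy, hz, add_zero]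
  | tmul k n =>
    obtain ⟨z, rfl⟩ := (galoisImage ρ).mkQ_surjective n
    obtain ⟨w, hw⟩ := h (Algebra.TensorProduct.map x (AlgHom.id R A) z)
    have := h2 w
    rw [hw, h0] at this
    rw [show k ⊗ₜ[B] (galoisImage ρ).mkQ z = k • ((1 : K) ⊗ₜ[B] (galoisImage ρ).mkQ z) by
      rw [TensorProduct.smul_tmul', smul_eq_mul, mul_one], this, smul_zero]

/-- The support of a finite module is the zero locus of its annihilator and is detected by residue
fields; vanishing descends from K to the residue field by faithful flatness. -/
lemma _root_.Module.annihilator_not_le_ker {B K N : Type*} [CommRing B] [Field K] [Algebra B K]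
    [AddCommGroup N] [Module B N] [Module.Finite B N] (h : Subsingleton (K ⊗[B] N)) :
    ¬ Module.annihilator B N ≤ RingHom.ker (algebraMap B K) := by
  obtain ⟨P, hP⟩ : ∃ P : PrimeSpectrum B, P.asIdeal = RingHom.ker (algebraMap B K) :=
    ⟨⟨_, RingHom.ker_isPrime (algebraMap B K)⟩, rfl⟩
  rw [← hP]
  intro hle
  have h1 := (Module.mem_support_iff_nontrivial_residueField_tensorProduct (M := N) P).mp
    (Module.mem_support_iff_of_finite.mpr hle)
  let k : P.asIdeal.ResidueField →ₐ[B] K :=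
    Ideal.ResidueField.liftₐ P.asIdeal (Algebra.ofId B K) hP.le fun b hb =>
      IsUnit.mk0 _ fun h0 => hb (hP.ge h0)
  let _ := k.toRingHom.toAlgebra
  have : IsScalarTower B P.asIdeal.ResidueField K :=
    IsScalarTower.of_algebraMap_eq fun b => (k.commutes b).symm
  have h2 : Subsingleton (K ⊗[P.asIdeal.ResidueField] (P.asIdeal.ResidueField ⊗[B] N)) :=
    (TensorProduct.AlgebraTensorModule.cancelBaseChange B P.asIdeal.ResidueField
      P.asIdeal.ResidueField K N).toEquiv.subsingleton
  rw [Module.FaithfullyFlat.subsingleton_tensorProduct_iff_right] at h2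
  exact not_subsingleton _ h2

lemma StabilizerTrivial.not_freeIdeal_le [Module.Finite R A] (hρ : IsCoaction ρ)
    {x : B →ₐ[R] K} (hx : StabilizerTrivial ρ x) : ¬ freeIdeal ρ ≤ RingHom.ker x := by
  let _ := x.toRingHom.toAlgebra
  exact Module.annihilator_not_le_ker (B := B) (K := K)
    (subsingleton_fiber (orbitMap_surjective hρ hx))

end Stabilizer

end Comodule

/-! ### Characteristic polynomials in dual bases -/

section CharPoly

variable {S M ι : Type*} [CommRing S] [AddCommGroup M] [Module S M] [Fintype ι]

/-- The matrix of an endomorphism in a dual basis. -/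
def dualBasisMatrix (e : ι → M) (e' : ι → M →ₗ[S] S) (φ : M →ₗ[S] M) : Matrix ι ι S :=
  Matrix.of fun i j => e' i (φ (e j))

variable {e : ι → M} {e' : ι → M →ₗ[S] S}

/-- A dual basis makes M a direct summand of S^ι, and the matrix is that of φ extended by zero.
Products are preserved, but the identity only becomes an idempotent matrix. -/
lemma IsDualBasis.matrix_comp (he : IsDualBasis e e') (φ ψ : M →ₗ[S] M) :
    dualBasisMatrix e e' (φ ∘ₗ ψ) = dualBasisMatrix e e' φ * dualBasisMatrix e e' ψ := by
  ext i j
  simp only [dualBasisMatrix, Matrix.of_apply, Matrix.mul_apply, LinearMap.comp_apply]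
  conv_lhs => rw [← he (ψ (e j))]
  simp [mul_comm]

/-- Conjugating matrices is not available, since σ and τ need not have inverse matrices; the
symmetry of the characteristic polynomial of a product replaces it. -/
lemma IsDualBasis.charpoly_conj [DecidableEq ι] (he : IsDualBasis e e') {φ σ τ ψ : M →ₗ[S] M}
    (h : τ ∘ₗ σ = LinearMap.id) (hψ : ψ = σ ∘ₗ φ ∘ₗ τ) :
    (dualBasisMatrix e e' ψ).charpoly = (dualBasisMatrix e e' φ).charpoly := by
  rw [hψ, he.matrix_comp, Matrix.charpoly_mul_comm, ← he.matrix_comp, LinearMap.comp_assoc, h,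
    LinearMap.comp_id]

/-- Cayley–Hamilton for the matrix, carried to M by the map π from S^ι, which intertwines the matrix
with φ and hits every m. -/
lemma IsDualBasis.aeval_charpoly [DecidableEq ι] (he : IsDualBasis e e') (φ : M →ₗ[S] M) :
    Polynomial.aeval φ (dualBasisMatrix e e' φ).charpoly = 0 := by
  let A := dualBasisMatrix e e' φ
  let π : (ι → S) →ₗ[S] M := Fintype.linearCombination S e
  have h1 : ∀ x, π (A.mulVec x) = φ (π x) := by
    intro x
    simp only [π, Fintype.linearCombination_apply, map_sum, map_smul, Matrix.mulVec, dotProduct,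
      Finset.sum_smul]
    rw [Finset.sum_comm]
    refine Finset.sum_congr rfl fun j _ => ?_
    conv_rhs => rw [← he (φ (e j)), Finset.smul_sum]
    refine Finset.sum_congr rfl fun i _ => ?_
    rw [smul_smul, mul_comm]
    rfl
  have h2 : ∀ (p : Polynomial S) x, π ((Polynomial.aeval A p).mulVec x) =
      Polynomial.aeval φ p (π x) := by
    intro p
    induction p using Polynomial.induction_on with
    | C a =>
      intro x
      simp [Algebra.algebraMap_eq_smul_one, Matrix.smul_mulVec]
    | add p q hp hq => intro x; simp [Matrix.add_mulVec, hp, hq]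
    | monomial n a h =>
      intro x
      rw [pow_succ, ← mul_assoc, map_mul, map_mul _ _ Polynomial.X, Polynomial.aeval_X,
        Polynomial.aeval_X, ← Matrix.mulVec_mulVec, h, h1]
      rfl
  ext m
  have h3 : m = π fun i => e' i m := (he m).symm
  have h4 := h2 A.charpoly (fun i => e' i m)
  rw [Matrix.aeval_self_charpoly, Matrix.zero_mulVec, map_zero, ← h3] at h4
  exact h4.symm

end CharPoly

/-! ### Integrality of B over the invariants -/

section Integral

open Coalgebra WithConv

variable {R A B : Type u} [CommRing R] [CommRing A] [HopfAlgebra R A] [CommRing B] [Algebra R B]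
  {ρ : B →ₐ[R] B ⊗[R] A} {n : ℕ}

/-- The characteristic polynomial of an element of `S ⊗ A` over `S`. -/
def charPolynomial (e : Fin n → A) (e' : Fin n → A →ₗ[R] R) {S : Type u} [CommRing S] [Algebra R S]
    (z : S ⊗[R] A) : Polynomial S :=
  (dualBasisMatrix (fun i => (1 : S) ⊗ₜ[R] e i) (fun i => extendFunctional S (e' i))
    (LinearMap.mulLeft S z)).charpoly

lemma charPolynomial_map (e : Fin n → A) (e' : Fin n → A →ₗ[R] R) {S S' : Type u} [CommRing S]
    [Algebra R S] [CommRing S'] [Algebra R S'] (ψ : S →ₐ[R] S') (z : S ⊗[R] A) :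
    charPolynomial e e' (Algebra.TensorProduct.map ψ (AlgHom.id R A) z) =
      (charPolynomial e e' z).map (ψ : S →+* S') := by
  rw [charPolynomial, charPolynomial, ← Matrix.charpoly_map]
  congr 1
  ext i j
  simp only [dualBasisMatrix, Matrix.of_apply, Matrix.map_apply, LinearMap.mulLeft_apply]
  induction z with
  | zero => simp
  | add y z hy hz => simp only [map_add, add_mul, hy, hz]
  | tmul s a => simp

/-- The polynomial at x is that of multiplication by h ↦ b(x h) on functions on G. Replacing x by x
g translates this function by g, which conjugates the multiplication and leaves the polynomial
unchanged. -/
lemma IsCoaction.coeff_charPolynomial_mem (hρ : IsCoaction ρ) {e : Fin n → A}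
    {e' : Fin n → A →ₗ[R] R} (he : IsDualBasis e e') (b : B) (k : ℕ) :
    (charPolynomial e e' (ρ b)).coeff k ∈ invariants ρ := by
  refine (AlgHom.mem_equalizer _ _ _).mpr ?_
  let S := B ⊗[R] A
  let h0 : WithConv (A →ₐ[R] S ⊗[R] A) := toConv Algebra.TensorProduct.includeRight
  let g0 : WithConv (A →ₐ[R] S ⊗[R] A) := toConv
    ((Algebra.TensorProduct.includeLeft : S →ₐ[R] S ⊗[R] A).comp Algebra.TensorProduct.includeRight)
  let x0 : B →ₐ[R] S ⊗[R] A :=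
    (Algebra.TensorProduct.includeLeft : S →ₐ[R] S ⊗[R] A).comp Algebra.TensorProduct.includeLeft
  -- Over S = B ⊗ A, with universal point (x₀, g₀), these are the substitutions h ↦ g₀ h and h ↦
  -- g₀⁻¹ h.
  let σ : S ⊗[R] A →ₐ[S] S ⊗[R] A := Algebra.TensorProduct.lift (Algebra.ofId S _)
    (g0 * h0).ofConv (fun _ _ => Commute.all _ _)
  let τ : S ⊗[R] A →ₐ[S] S ⊗[R] A := Algebra.TensorProduct.lift (Algebra.ofId S _)
    (inversePoint g0 * h0).ofConv (fun _ _ => Commute.all _ _)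
  have hσr : (σ.restrictScalars R).comp Algebra.TensorProduct.includeRight = (g0 * h0).ofConv := by
    ext a; simp [σ]
  have hτr : (τ.restrictScalars R).comp Algebra.TensorProduct.includeRight =
      (inversePoint g0 * h0).ofConv := by
    ext a; simp [τ]
  have hσl : (σ.restrictScalars R).comp Algebra.TensorProduct.includeLeft =
      (Algebra.TensorProduct.includeLeft : S →ₐ[R] S ⊗[R] A) := by
    refine AlgHom.ext fun s => ?_
    simp only [σ, AlgHom.comp_apply, AlgHom.restrictScalars_apply,
      Algebra.TensorProduct.includeLeft_apply, Algebra.TensorProduct.lift_tmul, map_one, mul_one]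
    rfl
  have hτl : (τ.restrictScalars R).comp Algebra.TensorProduct.includeLeft =
      (Algebra.TensorProduct.includeLeft : S →ₐ[R] S ⊗[R] A) := by
    refine AlgHom.ext fun s => ?_
    simp only [τ, AlgHom.comp_apply, AlgHom.restrictScalars_apply,
      Algebra.TensorProduct.includeLeft_apply, Algebra.TensorProduct.lift_tmul, map_one, mul_one]
    rfl
  have hτg : toConv ((τ.restrictScalars R).comp g0.ofConv) = g0 := by
    simp only [g0]
    rw [← AlgHom.comp_assoc, hτl]
  have hσg : toConv ((σ.restrictScalars R).comp g0.ofConv) = g0 := by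
    simp only [g0]
    rw [← AlgHom.comp_assoc, hσl]
  have hτσ : τ.toLinearMap ∘ₗ σ.toLinearMap = LinearMap.id := by
    have : τ.comp σ = AlgHom.id S _ := by
      refine Algebra.TensorProduct.ext (by ext) ?_
      have h1 : (τ.restrictScalars R).comp (g0 * h0).ofConv = h0.ofConv := by
        rw [AlgHom.comp_convMul_distrib, hτg]
        exact (congrArg ofConv (congrArg (g0 * ·) (congrArg toConv hτr))).trans
          (congrArg ofConv (mul_inversePoint_cancel_left g0 h0))
      refine AlgHom.ext fun a => ?_
      have h2 := DFunLike.congr_fun h1 a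
      rw [← hσr] at h2
      exact h2
    exact congrArg AlgHom.toLinearMap this
  have hστ : σ.toLinearMap ∘ₗ τ.toLinearMap = LinearMap.id := by
    have : σ.comp τ = AlgHom.id S _ := by
      refine Algebra.TensorProduct.ext (by ext) ?_
      have h1 : (σ.restrictScalars R).comp (inversePoint g0 * h0).ofConv = h0.ofConv := by
        rw [AlgHom.comp_convMul_distrib, comp_inversePoint, hσg]
        exact (congrArg ofConv (congrArg (inversePoint g0 * ·) (congrArg toConv hσr))).trans
          (congrArg ofConv (inversePoint_mul_cancel_left g0 h0))
      refine AlgHom.ext fun a => ?_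
      have h2 := DFunLike.congr_fun h1 a
      rw [← hτr] at h2
      exact h2
    exact congrArg AlgHom.toLinearMap this
  have hz : σ (Algebra.TensorProduct.map (Algebra.TensorProduct.includeLeft : B →ₐ[R] S)
      (AlgHom.id R A) (ρ b)) = Algebra.TensorProduct.map ρ (AlgHom.id R A) (ρ b) := by
    have h1 : (Algebra.TensorProduct.map (Algebra.TensorProduct.includeLeft : B →ₐ[R] S)
        (AlgHom.id R A)).comp ρ = act ρ x0 h0 := by
      rw [comp_eq_act]
      congr 1
    have h2 : (Algebra.TensorProduct.map ρ (AlgHom.id R A)).comp ρ =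
        act ρ (act ρ x0 g0) h0 := by
      rw [comp_eq_act]
      congr 1
      · have h3 : act ρ x0 g0 = (Algebra.TensorProduct.includeLeft : S →ₐ[R] S ⊗[R] A).comp ρ :=
          (comp_eq_act _).symm
        rw [h3]
        ext a
        simp
      · refine congrArg toConv ?_
        ext a; simp
    have h4 : (σ.restrictScalars R).comp (act ρ x0 h0) = act ρ (act ρ x0 g0) h0 := by
      rw [comp_act, ← hρ.act_mul]
      congr 1
      · rw [show x0 = _ from rfl, ← AlgHom.comp_assoc, hσl]
      · exact congrArg toConv hσr
    rw [← h1, ← h2] at h4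
    exact DFunLike.congr_fun h4 b
  have key : charPolynomial e e' (Algebra.TensorProduct.map ρ (AlgHom.id R A) (ρ b)) =
      charPolynomial e e' (Algebra.TensorProduct.map
        (Algebra.TensorProduct.includeLeft : B →ₐ[R] S) (AlgHom.id R A) (ρ b)) := by
    refine (he.baseChange (S' := S)).charpoly_conj (σ := σ.toLinearMap) (τ := τ.toLinearMap) hτσ ?_
    refine LinearMap.ext fun w => ?_
    have : σ (τ w) = w := LinearMap.congr_fun hστ w
    simp only [LinearMap.comp_apply, AlgHom.toLinearMap_apply, LinearMap.mulLeft_apply, map_mul,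
      hz, this]
  rw [charPolynomial_map, charPolynomial_map] at key
  simpa using congrArg (fun p => p.coeff k) key

/-- By Cayley–Hamilton ρ(b) is a root in B ⊗ A; evaluation at the unit of G, that is id ⊗ ε, sends
ρ(b) to b. -/
lemma IsCoaction.aeval_charPolynomial (hρ : IsCoaction ρ) {e : Fin n → A}
    {e' : Fin n → A →ₗ[R] R} (he : IsDualBasis e e') (b : B) :
    (charPolynomial e e' (ρ b)).eval b = 0 := by
  have h1 := (he.baseChange (S' := B)).aeval_charpoly (LinearMap.mulLeft B (ρ b))
  have h2 : Polynomial.aeval (ρ b) (charPolynomial e e' (ρ b)) = 0 := by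
    have h3 : ∀ p : Polynomial B, Polynomial.aeval (LinearMap.mulLeft B (ρ b)) p =
        LinearMap.mulLeft B (Polynomial.aeval (ρ b) p) := fun p =>
      Polynomial.aeval_algHom_apply (Algebra.lmul B (B ⊗[R] A)) (ρ b) p
    have h4 := LinearMap.congr_fun ((h3 _).symm.trans h1) 1
    simpa using! h4
  let E : B ⊗[R] A →ₐ[B] B := Algebra.TensorProduct.lift (AlgHom.id B B)
    ((Algebra.ofId R B).comp (Bialgebra.counitAlgHom R A)) (fun _ _ => Commute.all _ _)
  have hE : E (ρ b) = b := by
    exact DFunLike.congr_fun (hρ.act_one (AlgHom.id R B)) b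
  have h5 := congrArg E h2
  rw [← Polynomial.aeval_algHom_apply, hE, map_zero] at h5
  simpa using h5

/-- A comodule algebra is integral over its invariants. -/
lemma IsCoaction.isIntegral [Module.Finite R A] [Module.Projective R A] (hρ : IsCoaction ρ) :
    Algebra.IsIntegral (invariants ρ) B := by
  obtain ⟨n, e, e', he⟩ := exists_isDualBasis R A
  refine ⟨fun b => ?_⟩
  let p := charPolynomial e e' (ρ b)
  have hp : p.Monic := Matrix.charpoly_monic _
  have hl : p ∈ Polynomial.lifts (algebraMap (invariants ρ) B) := by
    rw [Polynomial.lifts_iff_coeff_lifts]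
    exact fun k => ⟨⟨_, hρ.coeff_charPolynomial_mem he b k⟩, rfl⟩
  rcases subsingleton_or_nontrivial B with hB | hB
  · rw [Subsingleton.elim b 0]
    exact isIntegral_zero
  obtain ⟨q, hq, -, hqm⟩ := Polynomial.lifts_and_degree_eq_and_monic hl hp
  refine ⟨q, hqm, ?_⟩
  rw [← Polynomial.eval_map, hq]
  exact hρ.aeval_charPolynomial he b

end Integral

open WithConv

/-! ### Points of the schemes with values in rings -/

section AffinePoints

variable {T : Scheme.{u}} {W : Type u} [CommRing W]

/-- The point of `Spec B` over `e : T ⟶ Spec W` given by a ring homomorphism `B → W`. -/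
def pt (e : T ⟶ Spec (.of W)) {B : Type u} [CommRing B] (φ : B →+* W) : T ⟶ Spec (.of B) :=
  e ≫ Spec.map (CommRingCat.ofHom φ)

variable {B B' : Type u} [CommRing B] [CommRing B']

lemma pt_comp_SpecMap (e : T ⟶ Spec (.of W)) (φ : B →+* W) (ψ : B' →+* B) :
    pt e φ ≫ Spec.map (CommRingCat.ofHom ψ) = pt e (φ.comp ψ) := by
  simp [pt]

lemma pt_id_injective {φ ψ : B →+* W} (h : pt (𝟙 (Spec (.of W))) φ = pt (𝟙 _) ψ) : φ = ψ := by
  simp only [pt, Category.id_comp] at h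
  have := Spec.map_injective h
  exact congrArg CommRingCat.Hom.hom this

/-- The universal affine target of a scheme. -/
abbrev toGlobal (T : Scheme.{u}) : T ⟶ Spec (.of Γ(T, ⊤)) := T.toSpecΓ

lemma exists_eq_pt (t : T ⟶ Spec (.of B)) : ∃ φ : B →+* Γ(T, ⊤), t = pt (toGlobal T) φ := by
  refine ⟨((Scheme.ΓSpecIso (.of B)).inv ≫ t.appTop).hom, ?_⟩
  rw [pt, CommRingCat.ofHom_hom, Spec.map_comp]
  have := Scheme.toSpecΓ_naturality_assoc t (Spec.map (Scheme.ΓSpecIso (.of B)).inv)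
  rw [toSpecΓ_SpecMap_ΓSpecIso_inv, Category.comp_id] at this
  exact this

lemma pt_toGlobal_injective {φ ψ : B →+* Γ(T, ⊤)} (h : pt (toGlobal T) φ = pt (toGlobal T) ψ) :
    φ = ψ := by
  have := congrArg Scheme.Hom.appTop h
  simp only [pt, Scheme.Hom.comp_appTop] at this
  rw [← cancel_epi (Scheme.ΓSpecIso (.of B)).inv] at this
  simp only [← Scheme.ΓSpecIso_inv_naturality_assoc] at this
  have h2 : (Scheme.ΓSpecIso (.of Γ(T, ⊤))).inv ≫ (toGlobal T).appTop = 𝟙 _ := by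
    refine (congrArg ((Scheme.ΓSpecIso (.of Γ(T, ⊤))).inv ≫ ·) (Scheme.toSpecΓ_appTop T)).trans ?_
    exact Iso.inv_hom_id _
  rw [h2, Category.comp_id, Category.comp_id] at this
  exact congrArg CommRingCat.Hom.hom this

lemma isUnit_of_pt {φ : B →+* Γ(T, ⊤)} {c : B}
    (h : ∀ z : T, c ∉ (show PrimeSpectrum B from pt (toGlobal T) φ z).asIdeal) : IsUnit (φ c) := by
  have h1 : ∀ z : T, z ∈ T.basicOpen (φ c) := by
    intro z
    rw [← Scheme.toSpecΓ_preimage_basicOpen]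
    exact h z
  refine RingedSpace.isUnit_of_isUnit_germ T.toRingedSpace ⊤ (φ c) fun x hx => ?_
  exact (Scheme.mem_basicOpen _ _ x hx).mp (h1 x)

end AffinePoints

/-! ### Coordinates (x, g, y) on the source of the Galois map -/

section Points

variable {R A B : Type u} [CommRing R] [CommRing A] [HopfAlgebra R A] [CommRing B] [Algebra R B]
  {ρ : B →ₐ[R] B ⊗[R] A}

lemma lift_actMap {T : Scheme.{u}} {W : Type u} [CommRing W] [Algebra R W] (e : T ⟶ Spec (.of W))
    (x : B →ₐ[R] W) (g : WithConv (A →ₐ[R] W)) (h) :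
    pullback.lift (f := toBase R B) (g := toBase R A) (pt e (x : B →+* W))
      (pt e (g.ofConv : A →+* W)) h ≫ actMap ρ = pt e (act ρ x g : B →+* W) := by
  have h1 : pullback.lift (f := toBase R B) (g := toBase R A) (pt e (x : B →+* W))
      (pt e (g.ofConv : A →+* W)) h ≫ (pullbackSpecIso R B A).hom =
      pt e (Algebra.TensorProduct.lift x g.ofConv (fun _ _ => Commute.all _ _) :
        B ⊗[R] A →+* W) := by
    rw [← cancel_mono (pullbackSpecIso R B A).inv, Category.assoc, Iso.hom_inv_id,
      Category.comp_id]
    apply pullback.hom_ext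
    · rw [pullback.lift_fst, Category.assoc, pullbackSpecIso_inv_fst, pt_comp_SpecMap]
      congr 1
      ext b
      simp
    · rw [pullback.lift_snd, Category.assoc, pullbackSpecIso_inv_snd, pt_comp_SpecMap]
      congr 1
      ext b
      simp
  rw [actMap, reassoc_of% h1]
  exact pt_comp_SpecMap e _ _

variable {Y' : Scheme.{u}} (f : Y' ⟶ quotient ρ)

/-- The action over `Y'`. -/
abbrev actionOver : ActionMap Y' := (actionOverQuotient ρ).baseChange f

/-- The source `X' ×_{Y'} G'` of the Galois map. -/
abbrev galoisSource : Scheme.{u} := pullback (actionOver f).x (actionOver f).g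

/-- The projection `X' ⟶ X`. -/
abbrev projX : (actionOver f).X ⟶ Spec (.of B) := (actionOverQuotient ρ).baseChangeFst f

/-- The projection `G' ⟶ G_Y`. -/
def projG : (actionOver f).G ⟶ (actionOverQuotient ρ).G :=
  pullback.fst (actionOverQuotient ρ).g f

variable (ρ) in
/-- The projection `G_Y ⟶ G`. -/
def groupProj : (actionOverQuotient ρ).G ⟶ Spec (.of A) :=
  pullback.fst (toBase R A) (toBase R (invariants ρ))

/-- The projection `X' ×_{Y'} G' ⟶ X`. -/
def sourceX : galoisSource f ⟶ Spec (.of B) := pullback.fst _ _ ≫ projX f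

/-- The projection `X' ×_{Y'} G' ⟶ G`. -/
def sourceG : galoisSource f ⟶ Spec (.of A) := pullback.snd _ _ ≫ projG f ≫ groupProj ρ

/-- The projection `X' ×_{Y'} G' ⟶ Y'`. -/
def sourceY : galoisSource f ⟶ Y' := pullback.fst _ _ ≫ (actionOver f).x

lemma projX_quotientMap : projX f ≫ quotientMap ρ = (actionOver f).x ≫ f :=
  pullback.condition (f := quotientMap ρ) (g := f)

lemma projG_comp : projG f ≫ (actionOverQuotient ρ).g = (actionOver f).g ≫ f :=
  pullback.condition

variable (ρ) in
lemma groupProj_toBase : groupProj ρ ≫ toBase R A =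
    (actionOverQuotient ρ).g ≫ toBase R (invariants ρ) :=
  pullback.condition

lemma hom_ext_X {T : Scheme.{u}} {u v : T ⟶ (actionOver f).X} (h1 : u ≫ projX f = v ≫ projX f)
    (h2 : u ≫ (actionOver f).x = v ≫ (actionOver f).x) : u = v :=
  pullback.hom_ext (f := quotientMap ρ) (g := f) h1 h2

lemma hom_ext_G {T : Scheme.{u}} {u v : T ⟶ (actionOver f).G} (h1 : u ≫ projG f = v ≫ projG f)
    (h2 : u ≫ (actionOver f).g = v ≫ (actionOver f).g) : u = v :=
  pullback.hom_ext (f := (actionOverQuotient ρ).g) (g := f) h1 h2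

lemma hom_ext_group {T : Scheme.{u}} {u v : T ⟶ (actionOverQuotient ρ).G}
    (h1 : u ≫ groupProj ρ = v ≫ groupProj ρ)
    (h2 : u ≫ (actionOverQuotient ρ).g = v ≫ (actionOverQuotient ρ).g) : u = v :=
  pullback.hom_ext (f := toBase R A) (g := toBase R (invariants ρ)) h1 h2

lemma sourceX_quotientMap : sourceX f ≫ quotientMap ρ = sourceY f ≫ f := by
  rw [sourceX, sourceY, Category.assoc, Category.assoc, projX_quotientMap]

lemma snd_comp_g : pullback.snd (actionOver f).x (actionOver f).g ≫ (actionOver f).g = sourceY f :=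
  pullback.condition.symm

lemma sourceX_toBase : sourceX f ≫ toBase R B = sourceG f ≫ toBase R A := by
  rw [sourceG, Category.assoc, Category.assoc, groupProj_toBase, reassoc_of% (projG_comp f),
    reassoc_of% (snd_comp_g f), ← quotientMap_toBase ρ, reassoc_of% (sourceX_quotientMap f)]

lemma source_hom_ext {T : Scheme.{u}} {u v : T ⟶ galoisSource f}
    (h1 : u ≫ sourceX f = v ≫ sourceX f) (h2 : u ≫ sourceG f = v ≫ sourceG f)
    (h3 : u ≫ sourceY f = v ≫ sourceY f) : u = v := by
  apply pullback.hom_ext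
  · exact hom_ext_X f (by simpa [sourceX] using h1) (by simpa [sourceY] using h3)
  · refine hom_ext_G f (hom_ext_group ?_ ?_) ?_
    · simpa [sourceG] using h2
    · simp only [Category.assoc, projG_comp]
      rw [reassoc_of% (snd_comp_g f), reassoc_of% h3]
    · rw [Category.assoc, Category.assoc, snd_comp_g, h3]

lemma exists_point {T : Scheme.{u}} (x : T ⟶ Spec (.of B)) (g : T ⟶ Spec (.of A)) (y : T ⟶ Y')
    (h1 : x ≫ quotientMap ρ = y ≫ f) (h2 : x ≫ toBase R B = g ≫ toBase R A) :
    ∃ u : T ⟶ galoisSource f, u ≫ sourceX f = x ∧ u ≫ sourceG f = g ∧ u ≫ sourceY f = y := by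
  have h3 : g ≫ toBase R A = (y ≫ f) ≫ toBase R (invariants ρ) := by
    rw [← h2, ← h1, Category.assoc, quotientMap_toBase]
  let G0 : T ⟶ (actionOverQuotient ρ).G := pullback.lift g (y ≫ f) h3
  let G1 : T ⟶ (actionOver f).G :=
    pullback.lift (f := (actionOverQuotient ρ).g) (g := f) G0 y (pullback.lift_snd _ _ _)
  let X1 : T ⟶ (actionOver f).X := pullback.lift (f := quotientMap ρ) (g := f) x y h1
  have hX : X1 ≫ (actionOver f).x = y := pullback.lift_snd _ _ _
  have hG : G1 ≫ (actionOver f).g = y := pullback.lift_snd _ _ _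
  have hG1 : G1 ≫ projG f = G0 := pullback.lift_fst _ _ _
  refine ⟨pullback.lift X1 G1 (hX.trans hG.symm), ?_, ?_, ?_⟩
  · rw [sourceX, pullback.lift_fst_assoc]
    exact pullback.lift_fst _ _ _
  · rw [sourceG, pullback.lift_snd_assoc, reassoc_of% hG1]
    exact pullback.lift_fst _ _ _
  · rw [sourceY, pullback.lift_fst_assoc]
    exact hX

lemma galois_snd : (actionOver f).galois ≫ pullback.snd _ _ = pullback.fst _ _ :=
  pullback.lift_snd _ _ _

lemma galois_fst_x : (actionOver f).galois ≫ pullback.fst _ _ ≫ (actionOver f).x = sourceY f := by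
  rw [pullback.condition, ← Category.assoc, galois_snd, sourceY]

variable (ρ) in
lemma quotient_act : (actionOverQuotient ρ).act =
    pullback.lift (f := toBase R B) (g := toBase R A)
      (pullback.fst (actionOverQuotient ρ).x (actionOverQuotient ρ).g)
      (pullback.snd (actionOverQuotient ρ).x (actionOverQuotient ρ).g ≫ groupProj ρ) (by
        rw [Category.assoc, groupProj_toBase, ← pullback.condition_assoc, ← quotientMap_toBase ρ]
        rfl) ≫ actMap ρ :=
  rfl

lemma sourceX_eq_projG : sourceX f ≫ quotientMap ρ =
    (pullback.snd _ _ ≫ projG f) ≫ (actionOverQuotient ρ).g := by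
  rw [sourceX_quotientMap, Category.assoc, projG_comp, reassoc_of% (snd_comp_g f)]

lemma act_projX : (actionOver f).act ≫ projX f =
    pullback.lift (f := (actionOverQuotient ρ).x) (g := (actionOverQuotient ρ).g) (sourceX f)
      (pullback.snd _ _ ≫ projG f) (sourceX_eq_projG f) ≫ (actionOverQuotient ρ).act :=
  pullback.lift_fst _ _ _

lemma galois_fst_projX : (actionOver f).galois ≫ pullback.fst _ _ ≫ projX f =
    pullback.lift (sourceX f) (sourceG f) (sourceX_toBase f) ≫ actMap ρ := by
  have h1 : (actionOver f).galois ≫ pullback.fst _ _ = (actionOver f).act :=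
    pullback.lift_fst _ _ _
  rw [reassoc_of% h1, act_projX, quotient_act]
  refine (Category.assoc _ _ _).symm.trans (congrArg (· ≫ actMap ρ) (pullback.hom_ext ?_ ?_))
  · refine (Category.assoc _ _ _).trans ((congrArg (_ ≫ ·) (pullback.lift_fst _ _ _)).trans ?_)
    exact (pullback.lift_fst _ _ _).trans (pullback.lift_fst _ _ _).symm
  · refine (Category.assoc _ _ _).trans ((congrArg (_ ≫ ·) (pullback.lift_snd _ _ _)).trans ?_)
    refine (Category.assoc _ _ _).symm.trans
      ((congrArg (· ≫ groupProj ρ) (pullback.lift_snd _ _ _)).trans ?_)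
    rw [pullback.lift_snd, sourceG, Category.assoc]

/-- Translates equations between scheme morphisms into the equations (x · g, x) = v over Y', so that
the results on ring-valued points apply. -/
lemma galois_eq_iff {T : Scheme.{u}} {u : T ⟶ galoisSource f}
    {v : T ⟶ pullback (actionOver f).x (actionOver f).x} :
    u ≫ (actionOver f).galois = v ↔
      u ≫ sourceX f = v ≫ pullback.snd _ _ ≫ projX f ∧
      u ≫ sourceY f = v ≫ pullback.snd _ _ ≫ (actionOver f).x ∧
      u ≫ pullback.lift (sourceX f) (sourceG f) (sourceX_toBase f) ≫ actMap ρ =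
        v ≫ pullback.fst _ _ ≫ projX f := by
  constructor
  · rintro rfl
    refine ⟨?_, ?_, ?_⟩
    · rw [Category.assoc, ← Category.assoc (actionOver f).galois, galois_snd, sourceX]
    · rw [Category.assoc, ← pullback.condition, galois_fst_x]
    · rw [Category.assoc, galois_fst_projX]
  · rintro ⟨h1, h2, h3⟩
    apply pullback.hom_ext
    · refine hom_ext_X f ?_ ?_
      · rw [Category.assoc, Category.assoc, galois_fst_projX, h3, Category.assoc]
      · rw [Category.assoc, Category.assoc, galois_fst_x, h2, Category.assoc, pullback.condition]
    · refine hom_ext_X f ?_ ?_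
      · rw [Category.assoc u, galois_snd, Category.assoc v, ← h1, sourceX, Category.assoc]
      · rw [Category.assoc u, galois_snd, Category.assoc v, ← h2, sourceY, Category.assoc]

lemma comp_lift_actMap {T : Scheme.{u}} {W : Type u} [CommRing W] [Algebra R W]
    {e : T ⟶ Spec (.of W)} {x : B →ₐ[R] W} {g : WithConv (A →ₐ[R] W)} {u : T ⟶ galoisSource f}
    (hx : u ≫ sourceX f = pt e (x : B →+* W)) (hg : u ≫ sourceG f = pt e (g.ofConv : A →+* W)) :
    u ≫ pullback.lift (sourceX f) (sourceG f) (sourceX_toBase f) ≫ actMap ρ =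
      pt e (act ρ x g : B →+* W) := by
  rw [← lift_actMap e x g (by rw [← hx, ← hg, Category.assoc, Category.assoc, sourceX_toBase]),
    ← Category.assoc]
  congr 1
  apply pullback.hom_ext
  · rw [Category.assoc, pullback.lift_fst, pullback.lift_fst, hx]
  · rw [Category.assoc, pullback.lift_snd, pullback.lift_snd, hg]

/-- The group component of a point as a homomorphism of algebras. -/
lemma exists_group_point {T : Scheme.{u}} [Algebra R Γ(T, ⊤)] {x : B →ₐ[R] Γ(T, ⊤)}
    {u : T ⟶ galoisSource f} (hx : u ≫ sourceX f = pt (toGlobal T) (x : B →+* Γ(T, ⊤))) :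
    ∃ g : WithConv (A →ₐ[R] Γ(T, ⊤)), u ≫ sourceG f =
      pt (toGlobal T) (g.ofConv : A →+* Γ(T, ⊤)) := by
  obtain ⟨γ, hγ⟩ := exists_eq_pt (u ≫ sourceG f)
  have h1 : pt (toGlobal T) (γ.comp (algebraMap R A)) =
      pt (toGlobal T) ((x : B →+* Γ(T, ⊤)).comp (algebraMap R B)) := by
    rw [← pt_comp_SpecMap, ← pt_comp_SpecMap, ← hγ, ← hx, Category.assoc, Category.assoc,
      sourceX_toBase]
  have h2 := pt_toGlobal_injective h1
  rw [AlgHom.comp_algebraMap_of_tower] at h2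
  exact ⟨toConv { γ with commutes' := fun r => RingHom.congr_fun h2 r }, hγ⟩

end Points

/-- The prime ideal of a point of `Spec B`. -/
abbrev primeIdeal {B : Type u} [CommRing B] (p : Spec (.of B)) : Ideal B :=
  PrimeSpectrum.asIdeal p

instance {B : Type u} [CommRing B] (p : Spec (.of B)) : (primeIdeal p).IsPrime :=
  PrimeSpectrum.isPrime p

/-! ### Inertia, freeness and the free ideal -/

section Galois

variable {R A B : Type u} [CommRing R] [CommRing A] [HopfAlgebra R A] [CommRing B] [Algebra R B]
  {ρ : B →ₐ[R] B ⊗[R] A} {Y' : Scheme.{u}} (f : Y' ⟶ quotient ρ)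

/-- Over the locus where the action is free, points are determined by their images under the
Galois map. -/
lemma galois_hom_ext {c : B} (hc : c ∈ freeIdeal ρ) {T : Scheme.{u}} {u v : T ⟶ galoisSource f}
    (h : u ≫ (actionOver f).galois = v ≫ (actionOver f).galois)
    (hu : ∀ z : T, c ∉ primeIdeal ((u ≫ sourceX f) z)) : u = v := by
  obtain ⟨φ, hφ⟩ := exists_eq_pt (u ≫ sourceX f)
  let _ : Algebra R Γ(T, ⊤) := (φ.comp (algebraMap R B)).toAlgebra
  let x : B →ₐ[R] Γ(T, ⊤) := { φ with commutes' := fun _ => rfl }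
  obtain ⟨a1, a2, a3⟩ := (galois_eq_iff f).1 h
  obtain ⟨b1, b2, b3⟩ := (galois_eq_iff f (u := v)).1 rfl
  have hx : u ≫ sourceX f = pt (toGlobal T) (x : B →+* Γ(T, ⊤)) := hφ
  have hv : v ≫ sourceX f = pt (toGlobal T) (x : B →+* Γ(T, ⊤)) := by rw [b1, ← a1, hx]
  obtain ⟨g, hg⟩ := exists_group_point f hx
  obtain ⟨g', hg'⟩ := exists_group_point f hv
  have h1 : act ρ x g = act ρ x g' := by
    apply AlgHom.coe_ringHom_injective
    apply pt_toGlobal_injective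
    rw [← comp_lift_actMap f hx hg, ← comp_lift_actMap f hv hg', a3, b3]
  have h2 : g = g' := by
    refine act_injective hc x ?_ h1
    refine isUnit_of_pt (φ := φ) fun z => ?_
    rw [← hφ]
    exact hu z
  refine source_hom_ext f (hx.trans hv.symm) ?_ (a2.trans b2.symm)
  rw [hg, hg', h2]

/-- A point of the source of the Galois map in the fibre over a point of the diagonal. -/
lemma exists_fiber_point {p' : (actionOver f).X} {W : Type u} [CommRing W] [Algebra R W]
    (t : Spec (.of W) ⟶ Spec ((actionOver f).X.residueField p')) {x : B →ₐ[R] W}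
    (hx : pt (𝟙 _) (x : B →+* W) = t ≫ (actionOver f).X.fromSpecResidueField p' ≫ projX f)
    {g : WithConv (A →ₐ[R] W)} (hg : act ρ x g = x) :
    ∃ u : Spec (.of W) ⟶ galoisSource f, u ≫ sourceG f = pt (𝟙 _) (g.ofConv : A →+* W) ∧
      u ≫ (actionOver f).galois =
        t ≫ (actionOver f).X.fromSpecResidueField p' ≫ pullback.diagonal (actionOver f).x := by
  obtain ⟨u, ux, ug, uy⟩ := exists_point f (pt (𝟙 _) (x : B →+* W))
    (pt (𝟙 _) (g.ofConv : A →+* W))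
    (t ≫ (actionOver f).X.fromSpecResidueField p' ≫ (actionOver f).x)
    (by rw [hx, Category.assoc, Category.assoc, projX_quotientMap, Category.assoc, Category.assoc])
    (by
      rw [pt_comp_SpecMap, pt_comp_SpecMap, AlgHom.comp_algebraMap_of_tower,
        AlgHom.comp_algebraMap_of_tower])
  refine ⟨u, ug, (galois_eq_iff f).2 ⟨?_, ?_, ?_⟩⟩
  · rw [ux, hx]
    simp only [Category.assoc, pullback.diagonal_snd_assoc]
  · rw [uy]
    simp only [Category.assoc, pullback.diagonal_snd_assoc]
  · rw [comp_lift_actMap f ux ug, hg, hx]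
    simp only [Category.assoc, pullback.diagonal_fst_assoc]

/-- K is the residue field of p', and x the resulting point of X. Inertia after base change is still
the stabilizer of x in G, so nothing is lost in passing from Y to Y'. -/
lemma IsCoaction.exists_stabilizerTrivial (hρ : IsCoaction ρ) (p' : (actionOver f).X)
    [Mono ((actionOver f).inertiaToSpec p')] :
    ∃ (K : Type u) (_ : Field K) (_ : Algebra R K) (x : B →ₐ[R] K),
      StabilizerTrivial ρ x ∧ RingHom.ker x = primeIdeal (projX f p') := by
  let K := (actionOver f).X.residueField p'
  let e : Spec K ⟶ Spec (.of B) := (actionOver f).X.fromSpecResidueField p' ≫ projX f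
  let φ : B →+* K := (Spec.preimage e).hom
  have hφ : Spec.map (CommRingCat.ofHom φ) = e := Spec.map_preimage e
  let _ : Algebra R K := (φ.comp (algebraMap R B)).toAlgebra
  let x : B →ₐ[R] K := { φ with commutes' := fun _ => rfl }
  refine ⟨K, inferInstance, inferInstance, x, ?_, ?_⟩
  · intro W _ _ i g hg
    let t : Spec (.of W) ⟶ Spec K := Spec.map (CommRingCat.ofHom (i : K →+* W))
    have hx : pt (𝟙 _) ((i.comp x : B →ₐ[R] W) : B →+* W) = t ≫ e := by
      rw [← hφ]
      exact (Category.id_comp _).trans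
        (Spec.map_comp (CommRingCat.ofHom φ) (CommRingCat.ofHom (i : K →+* W)))
    obtain ⟨u, ug, hu⟩ := exists_fiber_point f t hx hg
    obtain ⟨v, vg, hv⟩ := exists_fiber_point f t hx (hρ.act_one _)
    -- A stabilizing g and the unit give two points of the inertia over the same t.
    have h1 : pullback.lift u t hu = pullback.lift v t hv :=
      (cancel_mono ((actionOver f).inertiaToSpec p')).1
        ((pullback.lift_snd _ _ _).trans (pullback.lift_snd _ _ _).symm)
    have h2 : u = v := by
      rw [← pullback.lift_fst u t hu, h1, pullback.lift_fst]
    have h3 : (g.ofConv : A →+* W) = ((1 : WithConv (A →ₐ[R] W)).ofConv : A →+* W) :=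
      pt_id_injective (by rw [← ug, ← vg, h2])
    exact WithConv.ofConv_injective (AlgHom.coe_ringHom_injective h3)
  · have h4 : (Spec.map (CommRingCat.ofHom φ)) (IsLocalRing.closedPoint K) = projX f p' := by
      rw [hφ]
      exact congrArg (projX f) (Scheme.fromSpecResidueField_apply _ _)
    rw [← h4]
    ext b
    change φ b = 0 ↔ φ b ∈ IsLocalRing.maximalIdeal K
    rw [IsLocalRing.maximalIdeal_eq_bot]
    rfl

lemma IsCoaction.exists_invariant_of_mono [Module.Finite R A] [Module.Projective R A]
    (hρ : IsCoaction ρ) (p' : (actionOver f).X) [Mono ((actionOver f).inertiaToSpec p')] :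
    ∃ c : invariants ρ, (c : B) ∈ freeIdeal ρ ∧ (c : B) ∉ primeIdeal (projX f p') := by
  obtain ⟨K, _, _, x, hx, hk⟩ := hρ.exists_stabilizerTrivial f p'
  have h1 := hx.not_freeIdeal_le hρ
  rw [hk] at h1
  exact hρ.exists_invariant h1

lemma mono_inertiaToSpec_of_isFree (h : (actionOver f).IsFree) (p' : (actionOver f).X) :
    Mono ((actionOver f).inertiaToSpec p') := by
  have : IsClosedImmersion (actionOver f).galois := h
  exact inferInstanceAs (Mono (pullback.snd (actionOver f).galois _))

/-- The inclusion of the inertia group scheme into `X' ×_{Y'} G'`. -/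
def inertiaFst (p' : (actionOver f).X) : (actionOver f).inertia p' ⟶ galoisSource f :=
  pullback.fst _ _

lemma inertiaFst_galois (p' : (actionOver f).X) : inertiaFst f p' ≫ (actionOver f).galois =
    (actionOver f).inertiaToSpec p' ≫
      (actionOver f).X.fromSpecResidueField p' ≫ pullback.diagonal (actionOver f).x :=
  pullback.condition

/-- The unit of G is a section of the inertia over k(p'), and invertibility of c at p' makes the
structure morphism a monomorphism. -/
lemma IsCoaction.inertiaTrivial (hρ : IsCoaction ρ) {p' : (actionOver f).X} {c : B}
    (hc : c ∈ freeIdeal ρ) (hp : c ∉ primeIdeal (projX f p')) :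
    (actionOver f).InertiaTrivial p' := by
  let K := (actionOver f).X.residueField p'
  let e : Spec K ⟶ Spec (.of B) := (actionOver f).X.fromSpecResidueField p' ≫ projX f
  let φ : B →+* K := (Spec.preimage e).hom
  have hφ : Spec.map (CommRingCat.ofHom φ) = e := Spec.map_preimage e
  let _ : Algebra R K := (φ.comp (algebraMap R B)).toAlgebra
  let x : B →ₐ[R] K := { φ with commutes' := fun _ => rfl }
  have hx : pt (𝟙 _) (x : B →+* K) = 𝟙 (Spec K) ≫ e := by
    rw [← hφ]
    rfl
  obtain ⟨s, -, hs⟩ := exists_fiber_point f _ hx (hρ.act_one x)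
  have : IsSplitEpi ((actionOver f).inertiaToSpec p') :=
    ⟨⟨⟨pullback.lift s (𝟙 (Spec K)) hs, pullback.lift_snd _ _ _⟩⟩⟩
  have : Mono ((actionOver f).inertiaToSpec p') := by
    refine ⟨fun {Z} u v huv => pullback.hom_ext ?_ huv⟩
    have h1 := fun w : Z ⟶ (actionOver f).inertia p' =>
      (Category.assoc w _ _).trans ((congrArg (w ≫ ·) (inertiaFst_galois f p')).trans
        (Category.assoc w _ _).symm)
    refine galois_hom_ext f hc ((h1 u).trans ((congrArg (· ≫ _) huv).trans (h1 v).symm)) fun z => ?_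
    have h4 : (u ≫ inertiaFst f p') ≫ sourceX f =
        (u ≫ (actionOver f).inertiaToSpec p') ≫
          (actionOver f).X.fromSpecResidueField p' ≫ projX f := by
      rw [((galois_eq_iff f).1 (h1 u)).1]
      simp only [Category.assoc, pullback.diagonal_snd_assoc]
    change c ∉ primeIdeal (((u ≫ inertiaFst f p') ≫ sourceX f) z)
    rw [h4]
    change c ∉ primeIdeal (projX f ((actionOver f).X.fromSpecResidueField p' _))
    rwa [Scheme.fromSpecResidueField_apply]
  exact isIso_of_mono_of_isSplitEpi _

lemma mono_galois {c : B} (hc : c ∈ freeIdeal ρ)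
    (h : ∀ z : (actionOver f).X, c ∉ primeIdeal (projX f z)) : Mono (actionOver f).galois :=
  ⟨fun u _ huv => galois_hom_ext f hc huv fun z =>
    h (pullback.fst (actionOver f).x (actionOver f).g (u z))⟩

variable (ρ) in
lemma isFinite_g [Module.Finite R A] : IsFinite (actionOverQuotient ρ).g := by
  have : IsFinite (toBase R A) := by
    rw [IsFinite.SpecMap_iff]
    exact RingHom.finite_algebraMap.2 inferInstance
  exact inferInstanceAs (IsFinite (pullback.snd (toBase R A) (toBase R (invariants ρ))))

lemma isAffineHom_x : IsAffineHom (actionOver f).x :=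
  MorphismProperty.of_isPullback (P := @IsAffineHom.{u})
    (IsPullback.of_hasPullback (quotientMap ρ) f) inferInstance

/-- Followed by the second projection, which is affine, the Galois map becomes the finite projection
X' ×_{Y'} G' → X'. -/
lemma isFinite_galois [Module.Finite R A] : IsFinite (actionOver f).galois := by
  have := isFinite_g ρ
  have : IsFinite (actionOver f).g :=
    inferInstanceAs (IsFinite (pullback.snd (actionOverQuotient ρ).g f))
  have := isAffineHom_x f
  have : IsFinite ((actionOver f).galois ≫ pullback.snd _ _) := by
    rw [galois_snd]
    infer_instance
  exact IsFinite.of_comp (actionOver f).galois (pullback.snd _ _)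

lemma isFree_of_forall_notMem [Module.Finite R A] {c : B} (hc : c ∈ freeIdeal ρ)
    (h : ∀ z : (actionOver f).X, c ∉ primeIdeal (projX f z)) : (actionOver f).IsFree :=
  (IsClosedImmersion.iff_isFinite_and_mono _).2 ⟨isFinite_galois f, mono_galois f hc h⟩

end Galois

/-- A property that is local at the target and stable under base change holds for a base change
`X ×_Y Y' ⟶ Y'` if locally on `Y'` it is pulled back from a base change with the property. -/
lemma of_forall_exists_factorization {P : MorphismProperty Scheme.{u}}
    [P.IsStableUnderBaseChange] [IsZariskiLocalAtTarget P] {X Y Y' : Scheme.{u}} (π : X ⟶ Y)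
    (f : Y' ⟶ Y)
    (h : ∀ y : Y', ∃ (U : Y'.Opens) (V : Scheme.{u}) (v : V ⟶ Y) (k : U.toScheme ⟶ V), y ∈ U ∧
      k ≫ v = U.ι ≫ f ∧ P (pullback.fst v π)) : P (pullback.snd π f) := by
  refine IsZariskiLocalAtTarget.of_forall_exists_morphismRestrict fun y => ?_
  obtain ⟨U, V, v, k, hy, hk, hP⟩ := h y
  refine ⟨U, hy, ?_⟩
  have h1 : IsPullback (pullback.snd π f ∣_ U) ((pullback.snd π f ⁻¹ᵁ U).ι ≫ pullback.fst π f)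
      (U.ι ≫ f) π :=
    (isPullback_morphismRestrict (pullback.snd π f) U).paste_vert
      (IsPullback.of_hasPullback π f).flip
  rw [← hk] at h1
  exact P.of_isPullback (h1.flip.of_right' (IsPullback.of_hasPullback v π).flip) hP

/-! ### Surjectivity, flatness and finite presentation of X' → Y' -/

section Torsor

variable {R A B : Type u} [CommRing R] [CommRing A] [HopfAlgebra R A] [CommRing B] [Algebra R B]
  {ρ : B →ₐ[R] B ⊗[R] A} {Y' : Scheme.{u}} (f : Y' ⟶ quotient ρ)

/-- Lying over for the integral extension C ⊆ B. -/
lemma IsCoaction.surjective_quotientMap [Module.Finite R A] [Module.Projective R A]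
    (hρ : IsCoaction ρ) : Surjective (quotientMap ρ) := by
  have := hρ.isIntegral
  have : FaithfulSMul (invariants ρ) B :=
    (faithfulSMul_iff_algebraMap_injective _ _).2 Subtype.val_injective
  exact ⟨Algebra.IsIntegral.comap_surjective (invariants ρ) B⟩

lemma IsCoaction.surjective_x [Module.Finite R A] [Module.Projective R A]
    (hρ : IsCoaction ρ) : Surjective (actionOver f).x :=
  MorphismProperty.of_isPullback (P := @Surjective.{u})
    (IsPullback.of_hasPullback (quotientMap ρ) f) hρ.surjective_quotientMap

lemma notMem_quotientMap_iff {c : invariants ρ} {x : Spec (.of B)} :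
    c ∉ primeIdeal (quotientMap ρ x) ↔ (c : B) ∉ primeIdeal x :=
  Iff.rfl

lemma notMem_x_iff {c : invariants ρ} {z : (actionOver f).X} :
    c ∉ primeIdeal (f ((actionOver f).x z)) ↔ (c : B) ∉ primeIdeal (projX f z) := by
  rw [← notMem_quotientMap_iff]
  have h := congrArg (fun k : (actionOver f).X ⟶ quotient ρ => k z) (projX_quotientMap f)
  exact iff_of_eq (congrArg (fun y : quotient ρ => c ∉ primeIdeal y) h.symm)

lemma IsCoaction.flat_away [Module.Finite R A] [Module.Projective R A]
    (hρ : IsCoaction ρ) {c : invariants ρ} (hc : (c : B) ∈ freeIdeal ρ) :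
    Flat (pullback.fst (Spec.map (CommRingCat.ofHom
      (algebraMap (invariants ρ) (Localization.Away c)))) (quotientMap ρ)) := by
  have := hρ.projective_away hc (Localization.Away c)
  rw [← pullbackSpecIso_hom_fst']
  have : Flat (Spec.map (CommRingCat.ofHom (algebraMap (Localization.Away c)
      (Localization.Away c ⊗[invariants ρ] B)))) := by
    rw [Flat.SpecMap_iff]
    exact RingHom.flat_algebraMap_iff.2 (Module.Flat.of_projective (R := Localization.Away c))
  infer_instance

lemma IsCoaction.locallyOfFinitePresentation_away [Module.Finite R A] [Module.Projective R A]
    (hρ : IsCoaction ρ) {c : invariants ρ}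
    (hc : (c : B) ∈ freeIdeal ρ) :
    LocallyOfFinitePresentation (pullback.fst (Spec.map (CommRingCat.ofHom
      (algebraMap (invariants ρ) (Localization.Away c)))) (quotientMap ρ)) := by
  have := hρ.projective_away hc (Localization.Away c)
  have := hρ.finite_away hc (Localization.Away c)
  have := Module.finitePresentation_of_projective (Localization.Away c)
    (Localization.Away c ⊗[invariants ρ] B)
  rw [← pullbackSpecIso_hom_fst']
  have : LocallyOfFinitePresentation (Spec.map (CommRingCat.ofHom (algebraMap (Localization.Away c)
      (Localization.Away c ⊗[invariants ρ] B)))) := by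
    rw [LocallyOfFinitePresentation.SpecMap_iff]
    exact RingHom.finitePresentation_algebraMap.2 inferInstance
  infer_instance

/-- The locus of `Y` where the invariant `c` does not vanish. -/
def nonvanishing (c : invariants ρ) : (quotient ρ).Opens := PrimeSpectrum.basicOpen c

lemma exists_factorization_away {y : Y'} {c : invariants ρ} (hy : c ∉ primeIdeal (f y)) :
    ∃ (U : Y'.Opens) (k : U.toScheme ⟶ Spec (.of (Localization.Away c))), y ∈ U ∧
      k ≫ Spec.map (CommRingCat.ofHom (algebraMap (invariants ρ) (Localization.Away c))) =
        U.ι ≫ f := by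
  refine ⟨f ⁻¹ᵁ nonvanishing c, f ∣_ nonvanishing c ≫
    (basicOpenIsoSpecAway (R := .of (invariants ρ)) c).hom, hy, ?_⟩
  rw [← morphismRestrict_ι]
  exact (Category.assoc _ _ _).trans (congrArg (_ ≫ ·)
    (basicOpenIsoSpecAway_hom_SpecMap (R := .of (invariants ρ)) c))

lemma IsCoaction.flat_x [Module.Finite R A] [Module.Projective R A]
    (hρ : IsCoaction ρ)
    (h : ∀ y : Y', ∃ c : invariants ρ, (c : B) ∈ freeIdeal ρ ∧ c ∉ primeIdeal (f y)) :
    Flat (actionOver f).x := by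
  have : IsZariskiLocalAtTarget @Flat.{u} := HasRingHomProperty.instIsZariskiLocalAtTarget _
  refine of_forall_exists_factorization (P := @Flat.{u}) (quotientMap ρ) f fun y => ?_
  obtain ⟨c, hc, hy⟩ := h y
  obtain ⟨U, k, hyU, hk⟩ := exists_factorization_away f hy
  exact ⟨U, _, _, k, hyU, hk, hρ.flat_away hc⟩

lemma IsCoaction.locallyOfFinitePresentation_x [Module.Finite R A] [Module.Projective R A]
    (hρ : IsCoaction ρ)
    (h : ∀ y : Y', ∃ c : invariants ρ, (c : B) ∈ freeIdeal ρ ∧ c ∉ primeIdeal (f y)) :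
    LocallyOfFinitePresentation (actionOver f).x := by
  have : IsZariskiLocalAtTarget @LocallyOfFinitePresentation.{u} :=
    HasRingHomProperty.instIsZariskiLocalAtTarget _
  refine of_forall_exists_factorization (P := @LocallyOfFinitePresentation.{u}) (quotientMap ρ) f
    fun y => ?_
  obtain ⟨c, hc, hy⟩ := h y
  obtain ⟨U, k, hyU, hk⟩ := exists_factorization_away f hy
  exact ⟨U, _, _, k, hyU, hk, hρ.locallyOfFinitePresentation_away hc⟩

end Torsor

/-! ### Free actions and torsors -/

section Torsor

variable {R A B : Type u} [CommRing R] [CommRing A] [HopfAlgebra R A] [CommRing B] [Algebra R B]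
  {ρ : B →ₐ[R] B ⊗[R] A} {Y' : Scheme.{u}} (f : Y' ⟶ quotient ρ)

/-- Over the locus where the action is free, the Galois map is surjective on points. -/
lemma IsCoaction.exists_lift_galois [Module.Finite R A] [Module.Projective R A]
    (hρ : IsCoaction ρ) {c : invariants ρ}
    (hc : (c : B) ∈ freeIdeal ρ) {T : Scheme.{u}}
    (v : T ⟶ pullback (actionOver f).x (actionOver f).x)
    (hv : ∀ z : T, (c : B) ∉ primeIdeal ((v ≫ pullback.snd _ _ ≫ projX f) z)) :
    ∃ s : T ⟶ galoisSource f, s ≫ (actionOver f).galois = v := by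
  obtain ⟨φ, hφ⟩ := exists_eq_pt (v ≫ pullback.snd _ _ ≫ projX f)
  obtain ⟨ψ, hψ⟩ := exists_eq_pt (v ≫ pullback.fst _ _ ≫ projX f)
  have h1 : φ.comp (algebraMap (invariants ρ) B) = ψ.comp (algebraMap (invariants ρ) B) := by
    apply pt_toGlobal_injective
    rw [← pt_comp_SpecMap, ← pt_comp_SpecMap, ← hφ, ← hψ]
    simp only [Category.assoc]
    rw [projX_quotientMap, pullback.condition_assoc]
  let _ : Algebra R Γ(T, ⊤) := (φ.comp (algebraMap R B)).toAlgebra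
  let x : B →ₐ[R] Γ(T, ⊤) := { φ with commutes' := fun _ => rfl }
  let y : B →ₐ[R] Γ(T, ⊤) :=
    { ψ with commutes' := fun r => (RingHom.congr_fun h1 (algebraMap R (invariants ρ) r)).symm }
  have hcu : IsUnit (x c) := isUnit_of_pt (φ := φ) fun z => by
    rw [← hφ]
    exact hv z
  obtain ⟨g, hg⟩ := hρ.exists_act_eq hc x y (fun b => RingHom.congr_fun h1 b) hcu
  obtain ⟨s, sx, sg, sy⟩ := exists_point f (pt (toGlobal T) (x : B →+* Γ(T, ⊤)))
    (pt (toGlobal T) (g.ofConv : A →+* Γ(T, ⊤))) (v ≫ pullback.snd _ _ ≫ (actionOver f).x)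
    (by
      refine (congrArg (· ≫ quotientMap ρ) hφ.symm).trans ?_
      simp only [Category.assoc]
      rw [projX_quotientMap])
    (by
      rw [pt_comp_SpecMap, pt_comp_SpecMap, AlgHom.comp_algebraMap_of_tower,
        AlgHom.comp_algebraMap_of_tower])
  refine ⟨s, (galois_eq_iff f).2 ⟨sx.trans hφ.symm, sy, ?_⟩⟩
  rw [comp_lift_actMap f sx sg, hg]
  exact hψ.symm

/-- On the open set where c is invertible the inclusion lifts through the Galois map; a monomorphism
with a section is an isomorphism. -/
lemma IsCoaction.isIso_galois [Module.Finite R A] [Module.Projective R A]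
    (hρ : IsCoaction ρ) [Mono (actionOver f).galois]
    (h : ∀ y : Y', ∃ c : invariants ρ, (c : B) ∈ freeIdeal ρ ∧ c ∉ primeIdeal (f y)) :
    IsIso (actionOver f).galois := by
  refine IsZariskiLocalAtTarget.of_forall_exists_morphismRestrict (P := .isomorphisms _)
    fun z => ?_
  obtain ⟨c, hc, hz⟩ := h ((actionOver f).x (pullback.snd (actionOver f).x (actionOver f).x z))
  let D : (Spec (.of B)).Opens := PrimeSpectrum.basicOpen (c : B)
  let V := (pullback.snd (actionOver f).x (actionOver f).x ≫ projX f) ⁻¹ᵁ D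
  obtain ⟨s, hs⟩ := hρ.exists_lift_galois f hc V.ι fun w => w.2
  refine ⟨V, (notMem_x_iff f).1 hz, ?_⟩
  have hV := isPullback_morphismRestrict (actionOver f).galois V
  have : IsSplitEpi ((actionOver f).galois ∣_ V) :=
    ⟨⟨⟨hV.lift (𝟙 _) s (by rw [hs, Category.id_comp]), hV.lift_fst _ _ _⟩⟩⟩
  have : Mono ((actionOver f).galois ∣_ V) :=
    MorphismProperty.of_isPullback (P := .monomorphisms Scheme.{u}) hV.flip ‹_›
  exact isIso_of_mono_of_isSplitEpi _

/-- At a point p' above both p and y, the inertia is a base change of a closed immersion, so its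
structure morphism is a monomorphism. -/
lemma IsCoaction.exists_invariant_of_isFree [Module.Finite R A] [Module.Projective R A]
    (hρ : IsCoaction ρ) (h : (actionOver f).IsFree) {p : Spec (.of B)} {y : Y'}
    (hy : quotientMap ρ p = f y) :
    ∃ c : invariants ρ, (c : B) ∈ freeIdeal ρ ∧ (c : B) ∉ primeIdeal p := by
  obtain ⟨p', hp', -⟩ := Scheme.Pullback.exists_preimage_pullback (f := quotientMap ρ) (g := f)
    p y hy
  have := mono_inertiaToSpec_of_isFree f h p'
  rw [← hp']
  exact hρ.exists_invariant_of_mono f p'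

lemma IsCoaction.isTorsor_of_isFree [Module.Finite R A] [Module.Projective R A]
    (hρ : IsCoaction ρ) (h : (actionOver f).IsFree) : (actionOver f).IsTorsor := by
  have hc : ∀ y : Y', ∃ c : invariants ρ, (c : B) ∈ freeIdeal ρ ∧ c ∉ primeIdeal (f y) := by
    intro y
    obtain ⟨p, hp⟩ := hρ.surjective_quotientMap.surj (f y)
    rw [← hp]
    exact hρ.exists_invariant_of_isFree f h hp
  have : IsClosedImmersion (actionOver f).galois := h
  have := isAffineHom_x f
  exact ⟨hρ.flat_x f hc, hρ.surjective_x f, hρ.locallyOfFinitePresentation_x f hc, inferInstance,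
    inferInstance, hρ.isIso_galois f hc⟩

lemma isFree_of_isTorsor (h : (actionOver f).IsTorsor) : (actionOver f).IsFree := by
  have := h.isIso_galois
  exact inferInstanceAs (IsClosedImmersion (actionOver f).galois)

lemma isFree_nonvanishing [Module.Finite R A] {c : invariants ρ} (hc : (c : B) ∈ freeIdeal ρ) :
    (actionOver (nonvanishing c).ι).IsFree :=
  isFree_of_forall_notMem _ hc fun z =>
    (notMem_x_iff (nonvanishing c).ι).1 ((actionOver (nonvanishing c).ι).x z).2

lemma isAffine_nonvanishing (c : invariants ρ) : IsAffine (nonvanishing c) :=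
  IsAffineOpen.Spec_basicOpen (R := .of (invariants ρ)) c

end Torsor

end HopfAction

end

theorem mainTheorem7 {R A B : Type u} [CommRing R] [IsNoetherianRing R]
    [CommRing A] [HopfAlgebra R A] [Module.Finite R A] [Module.Flat R A]
    [CommRing B] [Algebra R B] (ρ : B →ₐ[R] B ⊗[R] A) (hρ : IsCoaction ρ)
    (p : Spec (.of B)) (q : quotient ρ) (hq : quotientMap ρ p = q) :
    List.TFAE [
      -- the inertia is trivial at `p` after a finite base change
      ∃ (Y₁ : Scheme.{u}) (f : Y₁ ⟶ quotient ρ)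
        (p₁ : ((actionOverQuotient ρ).baseChange f).X),
        IsFinite f ∧ (actionOverQuotient ρ).baseChangeFst f p₁ = p ∧
          ((actionOverQuotient ρ).baseChange f).InertiaTrivial p₁,
      -- the action is free on a finitely presented flat neighbourhood of `q`
      ∃ (Y' : Scheme.{u}) (f : Y' ⟶ quotient ρ), Flat f ∧ LocallyOfFinitePresentation f ∧
        QuasiCompact f ∧ QuasiSeparated f ∧ q ∈ Set.range f ∧
          ((actionOverQuotient ρ).baseChange f).IsFree,
      -- the action is free after a finite flat base change, locally around `q`
      ∃ (U : (quotient ρ).Opens) (Y' : Scheme.{u}) (f : Y' ⟶ U), IsFinite f ∧ Flat f ∧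
        q ∈ Set.range (f ≫ U.ι) ∧
          ((actionOverQuotient ρ).baseChange (f ≫ U.ι)).IsFree] ∧
    -- over a flat base, being free is the same as being a torsor
    ∀ (Y' : Scheme.{u}) (f : Y' ⟶ quotient ρ), Flat f →
      (((actionOverQuotient ρ).baseChange f).IsFree ↔
        ((actionOverQuotient ρ).baseChange f).IsTorsor) := by
  have : Module.FinitePresentation R A := Module.finitePresentation_of_finite R A
  have : Module.Projective R A := Module.Flat.projective_of_finitePresentation
  have key : (∃ c : invariants ρ, (c : B) ∈ freeIdeal ρ ∧ (c : B) ∉ primeIdeal p) → ∃ c :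
      invariants ρ, (c : B) ∈ freeIdeal ρ ∧ q ∈ nonvanishing c := by
    rintro ⟨c, hc, hp⟩
    exact ⟨c, hc, hq ▸ hp⟩
  refine ⟨?_, fun Y' f _ => ⟨hρ.isTorsor_of_isFree f, isFree_of_isTorsor f⟩⟩
  tfae_have 1 → 2 := by
    rintro ⟨Y₁, f, p₁, -, rfl, hp⟩
    have : IsIso (((actionOverQuotient ρ).baseChange f).inertiaToSpec p₁) := hp
    obtain ⟨c, hc, hcq⟩ := key (hρ.exists_invariant_of_mono f p₁)
    have := isAffine_nonvanishing c
    -- The neighbourhood is D(c) itself, with its open immersion; D(c) being affine gives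
    -- quasi-compactness.
    exact ⟨_, (nonvanishing c).ι, inferInstance, inferInstance, inferInstance, inferInstance,
      ⟨⟨q, hcq⟩, rfl⟩, isFree_nonvanishing hc⟩
  tfae_have 2 → 3 := by
    rintro ⟨Y', f, -, -, -, -, ⟨y, hy⟩, h⟩
    obtain ⟨c, hc, hcq⟩ := key (hρ.exists_invariant_of_isFree f h (hq.trans hy.symm))
    -- Here U = D(c), and the finite flat cover is the identity of U.
    refine ⟨nonvanishing c, _, 𝟙 _, inferInstance, inferInstance, ?_, ?_⟩
    · rw [Category.id_comp]
      exact ⟨⟨q, hcq⟩, rfl⟩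
    · rw [Category.id_comp]
      exact isFree_nonvanishing hc
  tfae_have 3 → 1 := by
    rintro ⟨U, Y', f, -, -, ⟨y, hy⟩, h⟩
    obtain ⟨c, hc, hcp⟩ := hρ.exists_invariant_of_isFree _ h (hq.trans hy.symm)
    obtain ⟨p₁, hp₁, -⟩ := Scheme.Pullback.exists_preimage_pullback (f := quotientMap ρ)
      (g := 𝟙 (quotient ρ)) p q hq
    -- The identity of Y serves as the finite base change: c does not vanish at p, so the inertia
    -- there is already trivial.
    refine ⟨_, 𝟙 _, p₁, inferInstance, hp₁, hρ.inertiaTrivial (𝟙 _) hc ?_⟩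
    exact hp₁ ▸ hcp
  tfae_finish
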